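/- Let $K\ge 2$ and consider a $K$-armed bandit in which all arms have the same reward distribution $\nu$ on $\mathbb{R}$, where $\nu$ has mean $\mu$, positive variance, and is $1$-sub-Gaussian: $\mathbb{E}_{X\sim\nu}[e^{\lambda(X-\mu)}]\le e^{\lambda^2/2}$ for all $\lambda\in\mathbb{R}$. In round $t$ the learner pulls an arm $A_t\in\{1,\dots,K\}$ and receives $X_t=\mu+\epsilon_{A_t,t}$, where for every arm $a$ the variable $\mu+\epsilon_{a,t}$ has law $\nu$ and $\epsilon_{a,t}$ is independent of the history $A_1,X_1,\dots,A_{t-1},X_{t-1}$ and of $A_t$. Let $n_{a,t}$ be the number of pulls of arm $a$ in rounds $1,\dots,t$ and $\widehat\mu_a(t)$ the empirical mean of the rewards received from it. An index algorithm with index $U_a(t)$ and horizon $T$ first pulls every arm once and then, for $K\le t<T$, chooses $A_{t+1}\in\arg\max_a U_a(t)$, with ties broken in an arbitrary way. Consider the indices - MOSS: $U_a(t)=\widehat\mu_a(t)+\sqrt{\dfrac{\max\{0,\log(T/(K n_{a,t}))\}}{n_{a,t}}}$; - Anytime-MOSS: $U_a(t)=\widehat\mu_a(t)+\sqrt{\dfrac{\max\{0,\log(t/(K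 n_{a,t}))\}}{n_{a,t}}}$; - Vanilla-MOSS: $U_a(t)=\widehat\mu_a(t)+\sqrt{\dfrac{\log(T/n_{a,t})}{n_{a,t}}}$; - OC-UCB with a parameter $\eta>0$: $U_a(t)=\widehat\mu_a(t)+\sqrt{\dfrac{2(1+\eta)}{n_{a,t}}\log(T/t)}$; - ADA-UCB: $U_a(t)=\widehat\mu_a(t)+\sqrt{\dfrac{2}{n_{a,t}}\max\{0,\log(T/H_a)\}}$ with $H_a=\sum_{j=1}^K\min\{n_{a,t},\sqrt{n_{a,t}n_{j,t}}\}$. Each of these five algorithms is unstable. That is, if for every $T$ the algorithm is run with horizon $T$, and $n_{a,T}$ denotes the number of pulls of arm $a$ in the $T$ rounds of that run, then it is not the case that for every arm $a$ there are non-random scalars $n^*_{a,T}$ with $n^*_{a,T}\to\infty$ and $n_{a,T}/n^*_{a,T}\to 1$ in probability as $T\to\infty$. -/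

import Mathlib

open MeasureTheory ProbabilityTheory Filter

universe u

namespace Bandit

noncomputable section

/-! ### Pull counts, empirical means, history

Rounds are numbered `1, 2, 3, …`; `A t` is the arm chosen and `X t` the reward received in
round `t`. -/

/-- The number `n_{a,t}` of pulls of arm `a` in the rounds `1, …, t`. -/
def pulls {Ω : Type*} {K : ℕ} (A : ℕ → Ω → Fin K) (a : Fin K) (t : ℕ) (ω : Ω) : ℕ :=
  ((Finset.Icc 1 t).filter (fun s => A s ω = a)).card

/-- The empirical mean of the rewards received from arm `a` in the rounds `1, …, t`. -/
def empMean {Ω : Type*} {K : ℕ} (A : ℕ → Ω → Fin K) (X : ℕ → Ω → ℝ)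
    (a : Fin K) (t : ℕ) (ω : Ω) : ℝ :=
  (∑ s ∈ (Finset.Icc 1 t).filter (fun s => A s ω = a), X s ω) / (pulls A a t ω : ℝ)

/-- The history `σ(A_1, X_1, …, A_t, X_t)`. -/
abbrev history {Ω : Type*} {K : ℕ} (A : ℕ → Ω → Fin K) (X : ℕ → Ω → ℝ) (t : ℕ) :
    MeasurableSpace Ω :=
  ⨆ s ∈ Finset.Icc 1 t,
    (MeasurableSpace.comap (A s) inferInstance ⊔ MeasurableSpace.comap (X s) inferInstance)

/-! ### The bandit model -/

/-- `A`, `X` are the actions and rewards of `T` rounds of interaction with the `K`-armed bandit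
whose arm `a` has reward distribution `ν a`, with mean `∫ x, x ∂(ν a)`. Pulling arm `a` in round `t`
gives its mean plus a noise `ε a t`, and the noise of round `t` is independent of
the history of the earlier rounds together with the action of round `t`. (If the action is a function
of the history this is independence of the history; the form chosen also lets the learner
randomize.) -/
structure IsInteraction {Ω : Type*} [MeasurableSpace Ω] {K : ℕ} (P : Measure Ω)
    (ν : Fin K → Measure ℝ) (T : ℕ) (ε : Fin K → ℕ → Ω → ℝ)
    (A : ℕ → Ω → Fin K) (X : ℕ → Ω → ℝ) : Prop where
  measurable_action : ∀ t ∈ Finset.Icc 1 T, Measurable (A t)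
  measurable_noise : ∀ t ∈ Finset.Icc 1 T, ∀ a, Measurable (ε a t)
  reward_eq : ∀ t ∈ Finset.Icc 1 T, ∀ ω, X t ω = (∫ x, x ∂(ν (A t ω))) + ε (A t ω) t ω
  reward_law : ∀ t ∈ Finset.Icc 1 T, ∀ a, P.map (fun ω => (∫ x, x ∂(ν a)) + ε a t ω) = ν a
  noise_indep : ∀ t ∈ Finset.Icc 1 T, ∀ a,
    Indep (MeasurableSpace.comap (ε a t) inferInstance)
      (history A X (t - 1) ⊔ MeasurableSpace.comap (A t) inferInstance) P

/-! ### Index algorithms -/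

/-- An upper confidence bound `U_a(t)`, as a function of the horizon `T`, the time `t`, the pull
counts `n` and the empirical means `m` of all arms at time `t`, and the arm `a`. -/
abbrev Index (K : ℕ) : Type := ℕ → ℕ → (Fin K → ℕ) → (Fin K → ℝ) → Fin K → ℝ

/-- The value `U_a(t)` of an index along a sequence of actions and rewards. -/
def indexAt {Ω : Type*} {K : ℕ} (U : Index K) (T : ℕ) (A : ℕ → Ω → Fin K) (X : ℕ → Ω → ℝ)
    (a : Fin K) (t : ℕ) (ω : Ω) : ℝ :=
  U T t (fun b => pulls A b t ω) (fun b => empMean A X b t ω) a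

/-- With horizon `T`, the learner first pulls each arm once (in any order) and then, in each round
`t + 1 ≤ T`, an arm that maximizes `U_a(t)`; ties are broken in any way. -/
structure FollowsIndex {Ω : Type*} {K : ℕ} (U : Index K) (T : ℕ)
    (A : ℕ → Ω → Fin K) (X : ℕ → Ω → ℝ) : Prop where
  init : K ≤ T → ∀ ω a, pulls A a K ω = 1
  optimism : ∀ t, K ≤ t → t < T → ∀ ω a,
    indexAt U T A X a t ω ≤ indexAt U T A X (A (t + 1) ω) t ω

/-- MOSS. -/
def moss (K : ℕ) : Index K := fun T _ n m a =>
  m a + √(max 0 (Real.log ((T : ℝ) / ((K : ℝ) * (n a : ℝ)))) / (n a : ℝ))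

/-- Anytime-MOSS. -/
def anytimeMoss (K : ℕ) : Index K := fun _ t n m a =>
  m a + √(max 0 (Real.log ((t : ℝ) / ((K : ℝ) * (n a : ℝ)))) / (n a : ℝ))

/-- Vanilla-MOSS. -/
def vanillaMoss (K : ℕ) : Index K := fun T _ n m a =>
  m a + √(Real.log ((T : ℝ) / (n a : ℝ)) / (n a : ℝ))

/-- OC-UCB with parameter `η`. -/
def ocUcb (K : ℕ) (η : ℝ) : Index K := fun T t n m a =>
  m a + √(2 * (1 + η) / (n a : ℝ) * Real.log ((T : ℝ) / (t : ℝ)))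

/-- The quantity `H_a = ∑_j min(n_a, √(n_a n_j))` of ADA-UCB. -/
def adaH {K : ℕ} (n : Fin K → ℕ) (a : Fin K) : ℝ :=
  ∑ j : Fin K, min (n a : ℝ) (√((n a : ℝ) * (n j : ℝ)))

/-- ADA-UCB. If `H_a > T` the logarithm is negative and the exploration bonus is `0`. -/
def adaUcb (K : ℕ) : Index K := fun T _ n m a =>
  m a + √(2 / (n a : ℝ) * max 0 (Real.log ((T : ℝ) / adaH n a)))

/-! ### Stability -/

/-- Stability of a bandit algorithm; `A T t` is the action in round `t` when the algorithm is
run with horizon `T`. For every arm there are non-random `n*_{a,T} → ∞` such that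
`n_{a,T} / n*_{a,T} → 1` in probability. -/
def IsStable {Ω : Type*} [MeasurableSpace Ω] {K : ℕ} (P : Measure Ω)
    (A : ℕ → ℕ → Ω → Fin K) : Prop :=
  ∀ a : Fin K, ∃ nstar : ℕ → ℝ,
    TendstoInMeasure P (fun (T : ℕ) (ω : Ω) => (pulls (A T) a T ω : ℝ) / nstar T) atTop
      (fun _ => (1 : ℝ)) ∧
    Tendsto nstar atTop atTop

/-- The algorithm with index `U` is unstable on the bandit with reward distributions `ν`:
whatever the underlying probability space and the way ties are broken, its runs with horizons
`T = 0, 1, 2, …` are not stable. -/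
def IsUnstable {K : ℕ} (ν : Fin K → Measure ℝ) (U : Index K) : Prop :=
  ∀ (Ω : Type u) [MeasurableSpace Ω] (P : Measure Ω) [IsProbabilityMeasure P]
    (ε : ℕ → Fin K → ℕ → Ω → ℝ) (A : ℕ → ℕ → Ω → Fin K) (X : ℕ → ℕ → Ω → ℝ),
    (∀ T, IsInteraction P ν T (ε T) (A T) (X T)) →
    (∀ T, FollowsIndex U T (A T) (X T)) →
    ¬ IsStable P A

end

end Bandit

/-
Reweighting the common reward law `ν` of one arm by the density `1 + θ * score ν`, with `θ` of order
`1 / √T`, raises the mean of that arm by `Δ = √(D / T)`, while the `χ²`-divergence over `T` rounds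
stays bounded. If `D` is large, then in the reweighted bandit the arm receives at least nine tenths
of the pulls with probability at least `1 / 2`: the index of the best arm stays above its mean while
the arm has been pulled rarely, and the index of an arm that has been pulled often is close to the
mean of that arm. By Cauchy-Schwarz, in the bandit with identical arms every arm therefore receives
nine tenths of the pulls with a probability bounded below uniformly in `T`. This cannot happen for
two arms if the pull counts concentrate around non-random scalars.
-/

namespace Bandit

open scoped ENNReal NNReal

section MeasureTheory

variable {Ω : Type*} {m : MeasurableSpace Ω} {P : Measure Ω}

theorem sq_setLIntegral_le {f : Ω → ℝ≥0∞} (hf : Measurable f) (S : Set Ω) :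
    (∫⁻ ω in S, f ω ∂P) ^ 2 ≤ (∫⁻ ω, f ω ^ 2 ∂P) * P S := by
  have holder := ENNReal.lintegral_mul_le_Lp_mul_Lq (P.restrict S) Real.HolderConjugate.two_two
    hf.aemeasurable (aemeasurable_const (b := 1))
  simp only [Pi.mul_apply, mul_one, ENNReal.rpow_two, one_pow, setLIntegral_const,
    one_mul] at holder
  calc (∫⁻ ω in S, f ω ∂P) ^ 2
      ≤ ((∫⁻ ω, f ω ^ 2 ∂P) ^ (1 / 2 : ℝ) * P S ^ (1 / 2 : ℝ)) ^ 2 := by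
        gcongr
        refine holder.trans ?_
        gcongr
        exact Measure.restrict_le_self
    _ = (∫⁻ ω, f ω ^ 2 ∂P) * P S := by
        rw [mul_pow, ← ENNReal.rpow_natCast, ← ENNReal.rpow_natCast, ← ENNReal.rpow_mul,
          ← ENNReal.rpow_mul]
        norm_num

theorem ville_ineq {ℱ : ℕ → MeasurableSpace Ω} (hℱ : Monotone ℱ) {T : ℕ} (hT : ℱ T ≤ m)
    {L : ℕ → Ω → ℝ≥0∞} (hL : ∀ t, Measurable[ℱ t] (L t))
    (hsuper : ∀ t < T, ∀ S, MeasurableSet[ℱ t] S →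
      ∫⁻ ω in S, L (t + 1) ω ∂P ≤ ∫⁻ ω in S, L t ω ∂P) (c : ℝ≥0∞) :
    c * P {ω | ∃ t ≤ T, c ≤ L t ω} ≤ ∫⁻ ω, L 0 ω ∂P := by
  set below : ℕ → Set Ω := fun t => {ω | ∀ s ≤ t, L s ω < c} with hbelow
  have measurable_below : ∀ t, MeasurableSet[ℱ t] (below t) := fun t => by
    simp only [hbelow, Set.ofPred_forall]
    exact .iInter fun s => .iInter fun hs => hℱ hs _ (hL s measurableSet_Iio)
  suffices h : ∀ t ≤ T, c * P (below t)ᶜ + ∫⁻ ω in below t, L t ω ∂P ≤ ∫⁻ ω, L 0 ω ∂P by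
    have compl_eq : {ω | ∃ t ≤ T, c ≤ L t ω} = (below T)ᶜ := by ext; simp [hbelow]
    exact compl_eq ▸ le_self_add.trans (h T le_rfl)
  have markov : ∀ t ≤ T, ∀ S, MeasurableSet S →
      c * P (S ∩ {ω | c ≤ L t ω}) + ∫⁻ ω in S \ {ω | c ≤ L t ω}, L t ω ∂P ≤
        ∫⁻ ω in S, L t ω ∂P := fun t ht S hS => by
    have hlevel : MeasurableSet {ω | c ≤ L t ω} :=
      (hℱ ht).trans hT _ (hL t measurableSet_Ici)
    rw [← lintegral_inter_add_sdiff _ S hlevel, ← setLIntegral_const]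
    gcongr ?_ + _
    exact setLIntegral_mono' (hS.inter hlevel) fun ω hω => hω.2
  intro t
  induction t with
  | zero =>
    intro _
    have h := markov 0 (Nat.zero_le T) Set.univ .univ
    rwa [Set.univ_inter, ← Set.compl_eq_univ_sdiff, setLIntegral_univ,
      show {ω | c ≤ L 0 ω} = (below 0)ᶜ by ext; simp [hbelow], compl_compl] at h
  | succ t ih =>
    intro ht
    have below_succ : below (t + 1) = below t \ {ω | c ≤ L (t + 1) ω} := by
      ext; simp [hbelow, Nat.le_succ_iff, or_imp, forall_and]
    have compl_succ : (below (t + 1))ᶜ = (below t)ᶜ ∪ below t ∩ {ω | c ≤ L (t + 1) ω} := by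
      rw [below_succ]; ext; simp only [Set.mem_compl_iff, Set.mem_sdiff, Set.mem_union,
        Set.mem_inter_iff]; tauto
    calc c * P (below (t + 1))ᶜ + ∫⁻ ω in below (t + 1), L (t + 1) ω ∂P
        ≤ c * P (below t)ᶜ + (c * P (below t ∩ {ω | c ≤ L (t + 1) ω}) +
            ∫⁻ ω in below t \ {ω | c ≤ L (t + 1) ω}, L (t + 1) ω ∂P) := by
          rw [← add_assoc, ← mul_add, compl_succ, below_succ]
          gcongr
          exact measure_union_le _ _
      _ ≤ c * P (below t)ᶜ + ∫⁻ ω in below t, L (t + 1) ω ∂P := by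
          gcongr
          exact markov _ ht _ ((hℱ (t.le_succ.trans ht)).trans hT _ (measurable_below t))
      _ ≤ c * P (below t)ᶜ + ∫⁻ ω in below t, L t ω ∂P :=
          add_le_add le_rfl (hsuper t ht _ (measurable_below t))
      _ ≤ ∫⁻ ω, L 0 ω ∂P := ih (t.le_succ.trans ht)

end MeasureTheory

section AdaptiveSampling

variable {Ω : Type*} {K : ℕ} {A : ℕ → Ω → Fin K} {X : ℕ → Ω → ℝ}

/-- The σ-algebra of what the learner knows when the reward of round `t + 1` is drawn. -/
abbrev preReward (A : ℕ → Ω → Fin K) (X : ℕ → Ω → ℝ) (t : ℕ) : MeasurableSpace Ω :=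
  history A X t ⊔ MeasurableSpace.comap (A (t + 1)) inferInstance

theorem history_mono : Monotone (history A X) := fun _ _ h =>
  biSup_mono fun _ hs => Finset.Icc_subset_Icc_right h hs

theorem measurable_action_history (t : ℕ) : Measurable[history A X (t + 1)] (A (t + 1)) :=
  (comap_measurable _).mono (le_sup_left.trans (le_biSup (fun s =>
    MeasurableSpace.comap (A s) inferInstance ⊔ MeasurableSpace.comap (X s) inferInstance)
    (by simp))) le_rfl

theorem measurable_reward_history (t : ℕ) : Measurable[history A X (t + 1)] (X (t + 1)) :=
  (comap_measurable _).mono (le_sup_right.trans (le_biSup (fun s =>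
    MeasurableSpace.comap (A s) inferInstance ⊔ MeasurableSpace.comap (X s) inferInstance)
    (by simp))) le_rfl

theorem history_le_preReward (t : ℕ) : history A X t ≤ preReward A X t := le_sup_left

theorem preReward_le_history (t : ℕ) : preReward A X t ≤ history A X (t + 1) :=
  sup_le (history_mono t.le_succ) (measurable_action_history t).comap_le

/-- The likelihood ratio after `t` rounds of the bandit in which the reward distribution of every
arm `a` has been reweighted by the density `G a`. -/
noncomputable def likelihood (G : Fin K → ℝ → ℝ≥0∞) (A : ℕ → Ω → Fin K) (X : ℕ → Ω → ℝ) (t : ℕ)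
    (ω : Ω) : ℝ≥0∞ :=
  ∏ s ∈ Finset.Icc 1 t, G (A s ω) (X s ω)

theorem likelihood_zero (G : Fin K → ℝ → ℝ≥0∞) (ω : Ω) : likelihood G A X 0 ω = 1 := by
  simp [likelihood]

theorem likelihood_succ (G : Fin K → ℝ → ℝ≥0∞) (t : ℕ) (ω : Ω) :
    likelihood G A X (t + 1) ω = likelihood G A X t ω * G (A (t + 1) ω) (X (t + 1) ω) :=
  Finset.prod_Icc_succ_top (by lia) _

theorem measurable_uncurry_comp {α β γ : Type*} [MeasurableSpace α] [Countable α]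
    [MeasurableSingletonClass α] [MeasurableSpace β] [MeasurableSpace γ] {m : MeasurableSpace Ω}
    {G : α → β → γ} (hG : ∀ a, Measurable (G a)) {f : Ω → α} {g : Ω → β} (hf : Measurable[m] f)
    (hg : Measurable[m] g) : Measurable[m] fun ω => G (f ω) (g ω) :=
  (measurable_from_prod_countable_right (f := Function.uncurry G) hG).comp (hf.prodMk hg)

theorem measurable_likelihood {G : Fin K → ℝ → ℝ≥0∞} (hG : ∀ a, Measurable (G a)) (t : ℕ) :
    Measurable[history A X t] (likelihood G A X t) := by
  induction t with
  | zero => simp only [funext (likelihood_zero G)]; exact measurable_const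
  | succ t ih =>
    simp only [funext (likelihood_succ G t)]
    exact (ih.mono (history_mono t.le_succ) le_rfl).mul
      (measurable_uncurry_comp hG (measurable_action_history t) (measurable_reward_history t))

variable [MeasurableSpace Ω] {P : Measure Ω} {ν : Fin K → Measure ℝ} {T : ℕ}

/-- In each of the rounds `1, …, T` the reward has, conditionally on the past and on the action `a`
of the round, the law `ν a`. Unlike `IsInteraction` this mentions no noise variables, so that it is
preserved by a change of measure. -/
structure IsAdaptive (P : Measure Ω) (ν : Fin K → Measure ℝ) (T : ℕ)
    (A : ℕ → Ω → Fin K) (X : ℕ → Ω → ℝ) : Prop where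
  measurable_action : ∀ t < T, Measurable (A (t + 1))
  measurable_reward : ∀ t < T, Measurable (X (t + 1))
  lintegral_mul : ∀ t < T, ∀ Z : Ω → ℝ≥0∞, Measurable[preReward A X t] Z →
    ∀ φ : Fin K → ℝ → ℝ≥0∞, (∀ a, Measurable (φ a)) →
      ∫⁻ ω, Z ω * φ (A (t + 1) ω) (X (t + 1) ω) ∂P =
        ∫⁻ ω, Z ω * ∫⁻ x, φ (A (t + 1) ω) x ∂(ν (A (t + 1) ω)) ∂P

theorem history_le (hA : ∀ t < T, Measurable (A (t + 1))) (hX : ∀ t < T, Measurable (X (t + 1))) :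
    history A X T ≤ ‹MeasurableSpace Ω› := by
  refine iSup₂_le fun s hs => ?_
  obtain ⟨t, rfl⟩ := Nat.exists_eq_add_of_le' (Finset.mem_Icc.mp hs).1
  have ht : t < T := (Finset.mem_Icc.mp hs).2
  exact sup_le (hA t ht).comap_le (hX t ht).comap_le

namespace IsInteraction

variable {ε : Fin K → ℕ → Ω → ℝ}

theorem measurable_action_succ (h : IsInteraction P ν T ε A X) {t : ℕ} (ht : t < T) :
    Measurable (A (t + 1)) :=
  h.measurable_action _ (Finset.mem_Icc.mpr ⟨by lia, ht⟩)

theorem measurable_noise_succ (h : IsInteraction P ν T ε A X) {t : ℕ} (ht : t < T) (a : Fin K) :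
    Measurable (ε a (t + 1)) :=
  h.measurable_noise _ (Finset.mem_Icc.mpr ⟨by lia, ht⟩) a

theorem reward_succ_eq (h : IsInteraction P ν T ε A X) {t : ℕ} (ht : t < T) (ω : Ω) :
    X (t + 1) ω = (∫ x, x ∂(ν (A (t + 1) ω))) + ε (A (t + 1) ω) (t + 1) ω :=
  h.reward_eq _ (Finset.mem_Icc.mpr ⟨by lia, ht⟩) ω

theorem measurable_reward_succ (h : IsInteraction P ν T ε A X) {t : ℕ} (ht : t < T) :
    Measurable (X (t + 1)) := by
  rw [funext (h.reward_succ_eq ht)]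
  exact measurable_uncurry_comp (G := fun a ω => (∫ x, x ∂(ν a)) + ε a (t + 1) ω)
    (fun a => (h.measurable_noise_succ ht a).const_add _) (h.measurable_action_succ ht)
    measurable_id

theorem preReward_le (h : IsInteraction P ν T ε A X) {t : ℕ} (ht : t < T) :
    preReward A X t ≤ ‹MeasurableSpace Ω› :=
  sup_le (history_le (fun _ hs => h.measurable_action_succ (hs.trans ht))
    fun _ hs => h.measurable_reward_succ (hs.trans ht)) (h.measurable_action_succ ht).comap_le

theorem lintegral_mul_noise (h : IsInteraction P ν T ε A X) {t : ℕ} (ht : t < T) (a : Fin K)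
    {Z : Ω → ℝ≥0∞} (hZ : Measurable[preReward A X t] Z) {φ : ℝ → ℝ≥0∞} (hφ : Measurable φ) :
    ∫⁻ ω, Z ω * φ ((∫ x, x ∂(ν a)) + ε a (t + 1) ω) ∂P = ∫⁻ ω, Z ω * ∫⁻ x, φ x ∂(ν a) ∂P := by
  have mem : t + 1 ∈ Finset.Icc 1 T := Finset.mem_Icc.mpr ⟨by lia, ht⟩
  refine (lintegral_mul_eq_lintegral_mul_lintegral_of_independent_measurableSpace
    (h.preReward_le ht) (h.measurable_noise_succ ht a).comap_le (h.noise_indep _ mem a).symm hZ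
    (hφ.comp ((comap_measurable (ε a (t + 1))).const_add (∫ x, x ∂(ν a))))).trans ?_
  rw [lintegral_mul_const _ (hZ.mono (h.preReward_le ht) le_rfl)]
  congr 1
  rw [← h.reward_law _ mem a, lintegral_map hφ ((h.measurable_noise_succ ht a).const_add _)]
  simp only [h.reward_law _ mem a, Function.comp_apply]

theorem isAdaptive (h : IsInteraction P ν T ε A X) : IsAdaptive P ν T A X := by
  refine ⟨fun t => h.measurable_action_succ, fun t => h.measurable_reward_succ,
    fun t ht Z hZ φ hφ => ?_⟩
  set ZA : Fin K → Ω → ℝ≥0∞ := fun a => (A (t + 1) ⁻¹' {a}).indicator Z with hZA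
  have sum_ZA (ω : Ω) (f : Fin K → ℝ≥0∞) : Z ω * f (A (t + 1) ω) = ∑ a, ZA a ω * f a := by
    rw [Finset.sum_eq_single (A (t + 1) ω)] <;> simp +contextual [hZA, eq_comm]
  have measurable_ZA (a : Fin K) : Measurable[preReward A X t] (ZA a) :=
    hZ.indicator ((comap_measurable (A (t + 1))).mono le_sup_right le_rfl
      (measurableSet_singleton a))
  have measurable_ZA' (a : Fin K) : Measurable (ZA a) :=
    (measurable_ZA a).mono (h.preReward_le ht) le_rfl
  set Y : Fin K → Ω → ℝ := fun a ω => (∫ x, x ∂(ν a)) + ε a (t + 1) ω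
  calc ∫⁻ ω, Z ω * φ (A (t + 1) ω) (X (t + 1) ω) ∂P
      = ∫⁻ ω, ∑ a, ZA a ω * φ a (Y a ω) ∂P := by
        simp only [h.reward_succ_eq ht]
        exact lintegral_congr fun ω => sum_ZA ω fun a => φ a (Y a ω)
    _ = ∑ a, ∫⁻ ω, ZA a ω * φ a (Y a ω) ∂P := lintegral_finsetSum _ fun a _ =>
        (measurable_ZA' a).mul ((hφ a).comp ((h.measurable_noise_succ ht a).const_add _))
    _ = ∑ a, ∫⁻ ω, ZA a ω * ∫⁻ x, φ a x ∂(ν a) ∂P :=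
        Finset.sum_congr rfl fun a _ => h.lintegral_mul_noise ht a (measurable_ZA a) (hφ a)
    _ = ∫⁻ ω, ∑ a, ZA a ω * ∫⁻ x, φ a x ∂(ν a) ∂P :=
        (lintegral_finsetSum _ fun a _ => (measurable_ZA' a).mul_const _).symm
    _ = ∫⁻ ω, Z ω * ∫⁻ x, φ (A (t + 1) ω) x ∂(ν (A (t + 1) ω)) ∂P :=
        lintegral_congr fun ω => (sum_ZA ω fun a => ∫⁻ x, φ a x ∂(ν a)).symm

end IsInteraction

namespace IsAdaptive

theorem mono (h : IsAdaptive P ν T A X) {t : ℕ} (ht : t ≤ T) : IsAdaptive P ν t A X where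
  measurable_action s hs := h.measurable_action s (hs.trans_le ht)
  measurable_reward s hs := h.measurable_reward s (hs.trans_le ht)
  lintegral_mul s hs := h.lintegral_mul s (hs.trans_le ht)

theorem history_le (h : IsAdaptive P ν T A X) : history A X T ≤ ‹MeasurableSpace Ω› :=
  Bandit.history_le h.measurable_action h.measurable_reward

variable {G : Fin K → ℝ → ℝ≥0∞}

theorem measurable_likelihood (h : IsAdaptive P ν T A X) (hG : ∀ a, Measurable (G a)) :
    Measurable (likelihood G A X T) :=
  (Bandit.measurable_likelihood hG T).mono h.history_le le_rfl

theorem lintegral_mul_likelihood_succ (h : IsAdaptive P ν T A X) (hG : ∀ a, Measurable (G a))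
    {t : ℕ} (ht : t < T) {Z : Ω → ℝ≥0∞} (hZ : Measurable[preReward A X t] Z) :
    ∫⁻ ω, Z ω * likelihood G A X (t + 1) ω ∂P =
      ∫⁻ ω, Z ω * likelihood G A X t ω * ∫⁻ x, G (A (t + 1) ω) x ∂(ν (A (t + 1) ω)) ∂P := by
  simp only [likelihood_succ, ← mul_assoc]
  exact h.lintegral_mul t ht _
    (hZ.mul ((Bandit.measurable_likelihood hG t).mono (history_le_preReward t) le_rfl)) G hG

theorem lintegral_mul_likelihood (h : IsAdaptive P ν T A X) (hG : ∀ a, Measurable (G a))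
    (hG1 : ∀ a, ∫⁻ x, G a x ∂(ν a) = 1) {t : ℕ} (ht : t ≤ T)
    {Z : Ω → ℝ≥0∞} (hZ : Measurable[history A X t] Z) :
    ∫⁻ ω, Z ω * likelihood G A X T ω ∂P = ∫⁻ ω, Z ω * likelihood G A X t ω ∂P := by
  induction T, ht using Nat.le_induction with
  | base => rfl
  | succ n hn ih =>
    rw [← ih (h.mono n.le_succ), h.lintegral_mul_likelihood_succ hG n.lt_succ_self
      (hZ.mono ((history_mono hn).trans (history_le_preReward n)) le_rfl)]
    simp only [hG1, mul_one]

theorem lintegral_withDensity_likelihood (h : IsAdaptive P ν T A X) (hG : ∀ a, Measurable (G a))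
    (hG1 : ∀ a, ∫⁻ x, G a x ∂(ν a) = 1) {t : ℕ} (ht : t ≤ T)
    {Z : Ω → ℝ≥0∞} (hZ : Measurable[history A X t] Z) :
    ∫⁻ ω, Z ω ∂(P.withDensity (likelihood G A X T)) = ∫⁻ ω, Z ω * likelihood G A X t ω ∂P := by
  rw [lintegral_withDensity_eq_lintegral_mul _ (h.measurable_likelihood hG)
    (hZ.mono (h.mono ht).history_le le_rfl), ← h.lintegral_mul_likelihood hG hG1 ht hZ]
  simp only [Pi.mul_apply, mul_comm]

theorem withDensity (h : IsAdaptive P ν T A X) (hG : ∀ a, Measurable (G a))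
    (hG1 : ∀ a, ∫⁻ x, G a x ∂(ν a) = 1) :
    IsAdaptive (P.withDensity (likelihood G A X T)) (fun a => (ν a).withDensity (G a)) T A X := by
  refine ⟨h.measurable_action, h.measurable_reward, fun t ht Z hZ φ hφ => ?_⟩
  set ψ : Fin K → ℝ≥0∞ := fun a => ∫⁻ x, φ a x ∂((ν a).withDensity (G a)) with hψ
  have hZ' : Measurable[history A X (t + 1)] Z := hZ.mono (preReward_le_history t) le_rfl
  have hψA : Measurable[preReward A X t] fun ω => ψ (A (t + 1) ω) :=
    (measurable_of_finite ψ).comp ((comap_measurable _).mono le_sup_right le_rfl)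
  have hφX : Measurable[history A X (t + 1)] fun ω => φ (A (t + 1) ω) (X (t + 1) ω) :=
    measurable_uncurry_comp hφ (measurable_action_history t) (measurable_reward_history t)
  have hL : Measurable[preReward A X t] (likelihood G A X t) :=
    (Bandit.measurable_likelihood hG t).mono (history_le_preReward t) le_rfl
  calc ∫⁻ ω, Z ω * φ (A (t + 1) ω) (X (t + 1) ω) ∂(P.withDensity (likelihood G A X T))
      = ∫⁻ ω, Z ω * likelihood G A X t ω *
          (G (A (t + 1) ω) (X (t + 1) ω) * φ (A (t + 1) ω) (X (t + 1) ω)) ∂P := by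
        refine (h.lintegral_withDensity_likelihood hG hG1 ht (hZ'.mul hφX)).trans ?_
        exact lintegral_congr fun ω => by rw [likelihood_succ, Pi.mul_apply]; ring
    _ = ∫⁻ ω, Z ω * likelihood G A X t ω * ψ (A (t + 1) ω) ∂P := by
        refine (h.lintegral_mul t ht _ (hZ.mul hL) (fun a x => G a x * φ a x)
          fun a => (hG a).mul (hφ a)).trans ?_
        simp only [hψ, lintegral_withDensity_eq_lintegral_mul _ (hG _) (hφ _), Pi.mul_apply]
    _ = ∫⁻ ω, Z ω * ψ (A (t + 1) ω) * likelihood G A X (t + 1) ω ∂P := by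
        refine .trans ?_ (h.lintegral_mul_likelihood_succ hG ht (hZ.mul hψA)).symm
        simp only [hG1, mul_one, mul_right_comm, Pi.mul_apply]
    _ = ∫⁻ ω, Z ω * ψ (A (t + 1) ω) ∂(P.withDensity (likelihood G A X T)) :=
        (h.lintegral_withDensity_likelihood hG hG1 ht
          (hZ'.mul (hψA.mono (preReward_le_history t) le_rfl))).symm

theorem isProbabilityMeasure_withDensity [IsProbabilityMeasure P] (h : IsAdaptive P ν T A X)
    (hG : ∀ a, Measurable (G a)) (hG1 : ∀ a, ∫⁻ x, G a x ∂(ν a) = 1) :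
    IsProbabilityMeasure (P.withDensity (likelihood G A X T)) := by
  constructor
  simpa [likelihood_zero] using
    h.lintegral_withDensity_likelihood hG hG1 (Nat.zero_le T) (Z := 1) measurable_const

theorem lintegral_likelihood_le [IsProbabilityMeasure P] (h : IsAdaptive P ν T A X)
    (hG : ∀ a, Measurable (G a)) {r : ℝ≥0∞} (hr : ∀ a, ∫⁻ x, G a x ∂(ν a) ≤ r) :
    ∫⁻ ω, likelihood G A X T ω ∂P ≤ r ^ T := by
  induction T with
  | zero => simp [likelihood_zero]
  | succ t ih =>
    have hL := (h.mono t.le_succ).measurable_likelihood hG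
    calc ∫⁻ ω, likelihood G A X (t + 1) ω ∂P
        = ∫⁻ ω, likelihood G A X t ω * ∫⁻ x, G (A (t + 1) ω) x ∂(ν (A (t + 1) ω)) ∂P := by
          simpa using h.lintegral_mul_likelihood_succ hG t.lt_succ_self (Z := 1) measurable_const
      _ ≤ ∫⁻ ω, likelihood G A X t ω * r ∂P := by gcongr; exact hr _
      _ ≤ r ^ t * r := by rw [lintegral_mul_const _ hL]; gcongr; exact ih (h.mono t.le_succ)
      _ = r ^ (t + 1) := (pow_succ r t).symm

theorem sq_withDensity_likelihood_le [IsProbabilityMeasure P] (h : IsAdaptive P ν T A X)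
    (hG : ∀ a, Measurable (G a)) {r : ℝ≥0∞} (hr : ∀ a, ∫⁻ x, G a x ^ 2 ∂(ν a) ≤ r)
    (S : Set Ω) : (P.withDensity (likelihood G A X T) S) ^ 2 ≤ r ^ T * P S := by
  rw [withDensity_apply']
  refine (sq_setLIntegral_le (h.measurable_likelihood hG) S).trans ?_
  gcongr
  simpa only [likelihood, Finset.prod_pow] using
    h.lintegral_likelihood_le (G := fun a x => G a x ^ 2) (fun a => (hG a).pow_const 2) hr

theorem mul_measure_exists_le_likelihood_le [IsProbabilityMeasure P] (h : IsAdaptive P ν T A X)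
    (hG : ∀ a, Measurable (G a)) (hG1 : ∀ a, ∫⁻ x, G a x ∂(ν a) ≤ 1) (c : ℝ≥0∞) :
    c * P {ω | ∃ t ≤ T, c ≤ likelihood G A X t ω} ≤ 1 := by
  have super (t : ℕ) (ht : t < T) (S : Set Ω) (hS : MeasurableSet[history A X t] S) :
      ∫⁻ ω in S, likelihood G A X (t + 1) ω ∂P ≤ ∫⁻ ω in S, likelihood G A X t ω ∂P := by
    have hS' : MeasurableSet S := (h.mono ht.le).history_le _ hS
    have indicator_mul (t : ℕ) : S.indicator (likelihood G A X t) =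
        fun ω => S.indicator 1 ω * likelihood G A X t ω := by
      funext ω; by_cases hω : ω ∈ S <;> simp [hω]
    have measurable_indicator : Measurable[history A X t] (S.indicator (1 : Ω → ℝ≥0∞)) :=
      measurable_const.indicator hS
    rw [← lintegral_indicator hS', ← lintegral_indicator hS', indicator_mul, indicator_mul,
      h.lintegral_mul_likelihood_succ hG ht
        (measurable_indicator.mono (history_le_preReward t) le_rfl)]
    exact lintegral_mono fun ω => mul_le_of_le_one_right' (hG1 _)
  simpa [likelihood_zero] using
    ville_ineq history_mono h.history_le (Bandit.measurable_likelihood hG) super c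

end IsAdaptive

end AdaptiveSampling

section PullCounts

variable {Ω : Type*} {K : ℕ} {A : ℕ → Ω → Fin K} {X : ℕ → Ω → ℝ}

theorem pulls_succ (a : Fin K) (t : ℕ) (ω : Ω) :
    pulls A a (t + 1) ω = pulls A a t ω + if A (t + 1) ω = a then 1 else 0 := by
  simp only [pulls, Finset.card_filter, Finset.sum_Icc_succ_top (Nat.le_add_left 1 t)]

theorem pulls_le (a : Fin K) (t : ℕ) (ω : Ω) : pulls A a t ω ≤ t := by
  simpa [pulls] using Finset.card_filter_le (Finset.Icc 1 t) (fun s => A s ω = a)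

theorem pulls_mono (a : Fin K) (ω : Ω) : Monotone fun t => pulls A a t ω := fun _ _ h =>
  Finset.card_le_card (Finset.filter_subset_filter _ (Finset.Icc_subset_Icc_right h))

theorem sum_pulls (t : ℕ) (ω : Ω) : ∑ a, pulls A a t ω = t := by
  simpa [pulls] using (Finset.card_eq_sum_card_fiberwise (s := Finset.Icc 1 t)
    (t := Finset.univ) (f := fun s => A s ω) (by simp [Set.MapsTo])).symm

theorem exists_last_pull {b : Fin K} {s : ℕ} {ω : Ω} (h : 0 < pulls A b s ω) :
    ∃ t < s, A (t + 1) ω = b ∧ pulls A b t ω + 1 = pulls A b s ω := by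
  induction s with
  | zero => simp [pulls] at h
  | succ s ih =>
    by_cases hb : A (s + 1) ω = b
    · exact ⟨s, s.lt_succ_self, hb, by rw [pulls_succ, if_pos hb]⟩
    · rw [pulls_succ, if_neg hb, add_zero] at h ⊢
      obtain ⟨t, ht, hlast⟩ := ih h
      exact ⟨t, ht.trans s.lt_succ_self, hlast⟩

/-- The sum of the rewards received from arm `a` in the rounds `1, …, t`, each reduced by `m`. -/
noncomputable def deviation (A : ℕ → Ω → Fin K) (X : ℕ → Ω → ℝ) (a : Fin K) (m : ℝ) (t : ℕ)
    (ω : Ω) : ℝ :=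
  ∑ s ∈ (Finset.Icc 1 t).filter (fun s => A s ω = a), (X s ω - m)

theorem abs_deviation (a : Fin K) (m : ℝ) (t : ℕ) (ω : Ω) :
    |deviation A X a m t ω| = |empMean A X a t ω - m| * pulls A a t ω := by
  have hdev : deviation A X a m t ω =
      (∑ s ∈ (Finset.Icc 1 t).filter (fun s => A s ω = a), X s ω) - pulls A a t ω * m := by
    rw [deviation, Finset.sum_sub_distrib, Finset.sum_const, nsmul_eq_mul, pulls]
  obtain h | h := (Finset.Icc 1 t |>.filter fun s => A s ω = a).eq_empty_or_nonempty
  · simp [deviation, pulls, h]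
  · have hn : (pulls A a t ω : ℝ) ≠ 0 := Nat.cast_ne_zero.mpr h.card_ne_zero
    rw [hdev, empMean, ← Nat.abs_cast (pulls A a t ω), ← abs_mul, Nat.abs_cast]
    congr 1
    field_simp

end PullCounts

section Deviations

variable {Ω : Type*} {K : ℕ} {A : ℕ → Ω → Fin K} {X : ℕ → Ω → ℝ}

/-- The density that turns the likelihood ratio into the exponential supermartingale with parameter
`l` of the rewards from arm `a`, centred at `m` and with variance proxy `C`. -/
noncomputable def expWeight (a : Fin K) (m : ℝ) (C : ℝ≥0) (l : ℝ) (b : Fin K) (x : ℝ) : ℝ≥0∞ :=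
  if b = a then ENNReal.ofReal (Real.exp (l * (x - m) - C * l ^ 2 / 2)) else 1

theorem measurable_expWeight (a : Fin K) (m : ℝ) (C : ℝ≥0) (l : ℝ) (b : Fin K) :
    Measurable (expWeight a m C l b) := by
  unfold expWeight
  split_ifs <;> fun_prop

theorem likelihood_expWeight (a : Fin K) (m : ℝ) (C : ℝ≥0) (l : ℝ) (t : ℕ) (ω : Ω) :
    likelihood (expWeight a m C l) A X t ω =
      ENNReal.ofReal (Real.exp (l * deviation A X a m t ω - C * l ^ 2 / 2 * pulls A a t ω)) := by
  simp only [likelihood, expWeight]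
  rw [← Finset.prod_filter, ← ENNReal.ofReal_prod_of_nonneg fun _ _ => Real.exp_nonneg _,
    ← Real.exp_sum, Finset.sum_sub_distrib, ← Finset.mul_sum, Finset.sum_const, nsmul_eq_mul,
    mul_comm ((Finset.card _ : ℕ) : ℝ)]
  rfl

theorem lintegral_expWeight_le {ν : Fin K → Measure ℝ} [∀ b, IsProbabilityMeasure (ν b)]
    {a : Fin K} {m : ℝ} {C : ℝ≥0} (h : HasSubgaussianMGF (fun x => x - m) C (ν a)) (l : ℝ)
    (b : Fin K) : ∫⁻ x, expWeight a m C l b x ∂(ν b) ≤ 1 := by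
  unfold expWeight
  split_ifs with hb
  · subst hb
    simp only [sub_eq_add_neg _ (C * l ^ 2 / 2 : ℝ), Real.exp_add]
    rw [← ofReal_integral_eq_lintegral_ofReal ((h.integrable_exp_mul l).mul_const _)
      (.of_forall fun x => by positivity), integral_mul_const, ENNReal.ofReal_le_one,
      Real.exp_neg, mul_inv_le_iff₀ (Real.exp_pos _), one_mul]
    exact h.mgf_le l
  · simp

namespace IsAdaptive

variable [MeasurableSpace Ω] {P : Measure Ω} [IsProbabilityMeasure P]
  {ν : Fin K → Measure ℝ} [∀ b, IsProbabilityMeasure (ν b)] {T : ℕ} {a : Fin K} {m : ℝ} {C : ℝ≥0}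

theorem measure_exists_le_exp_neg (h : IsAdaptive P ν T A X)
    (hs : HasSubgaussianMGF (fun x => x - m) C (ν a)) (l y : ℝ) :
    P {ω | ∃ t ≤ T, y ≤ l * deviation A X a m t ω - C * l ^ 2 / 2 * pulls A a t ω} ≤
      ENNReal.ofReal (Real.exp (-y)) := by
  have hville := h.mul_measure_exists_le_likelihood_le (measurable_expWeight a m C l)
    (lintegral_expWeight_le hs l) (ENNReal.ofReal (Real.exp y))
  simp only [likelihood_expWeight, ENNReal.ofReal_le_ofReal_iff (Real.exp_nonneg _),
    Real.exp_le_exp] at hville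
  rwa [Real.exp_neg, ENNReal.ofReal_inv_of_pos (Real.exp_pos _), ENNReal.le_inv_iff_mul_le,
    mul_comm]

theorem measure_exists_abs_le_exp_neg (h : IsAdaptive P ν T A X)
    (hs : HasSubgaussianMGF (fun x => x - m) C (ν a)) (l y : ℝ) :
    P {ω | ∃ t ≤ T, y ≤ l * |deviation A X a m t ω| - C * l ^ 2 / 2 * pulls A a t ω} ≤
      ENNReal.ofReal (2 * Real.exp (-y)) := by
  have hsub : {ω | ∃ t ≤ T, y ≤ l * |deviation A X a m t ω| - C * l ^ 2 / 2 * pulls A a t ω} ⊆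
      {ω | ∃ t ≤ T, y ≤ l * deviation A X a m t ω - C * l ^ 2 / 2 * pulls A a t ω} ∪
      {ω | ∃ t ≤ T, y ≤ (-l) * deviation A X a m t ω - C * (-l) ^ 2 / 2 * pulls A a t ω} := by
    rintro ω ⟨t, ht, hy⟩
    rcases abs_choice (deviation A X a m t ω) with habs | habs <;> rw [habs] at hy
    · exact .inl ⟨t, ht, hy⟩
    · exact .inr ⟨t, ht, by simpa using hy⟩
  refine (measure_mono hsub).trans ((measure_union_le _ _).trans ?_)
  rw [two_mul, ENNReal.ofReal_add (Real.exp_nonneg _) (Real.exp_nonneg _)]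
  exact add_le_add (h.measure_exists_le_exp_neg hs l y) (h.measure_exists_le_exp_neg hs (-l) y)

theorem measure_exists_mul_pulls_le_abs_deviation (h : IsAdaptive P ν T A X)
    (hs : HasSubgaussianMGF (fun x => x - m) C (ν a)) (hC : 0 < C) {x : ℝ} (hx : 0 < x) (N : ℝ) :
    P {ω | ∃ t ≤ T, N ≤ pulls A a t ω ∧ x * pulls A a t ω ≤ |deviation A X a m t ω|} ≤
      ENNReal.ofReal (2 * Real.exp (-(x ^ 2 * N / (2 * C)))) := by
  refine (measure_mono ?_).trans (h.measure_exists_abs_le_exp_neg hs (x / C) (x ^ 2 * N / (2 * C)))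
  rintro ω ⟨t, ht, hN, hd⟩
  refine ⟨t, ht, ?_⟩
  calc x ^ 2 * N / (2 * C) ≤ x ^ 2 * pulls A a t ω / (2 * C) := by gcongr
    _ = x / C * (x * pulls A a t ω) - C * (x / C) ^ 2 / 2 * pulls A a t ω := by field_simp; ring
    _ ≤ _ := by gcongr

theorem measure_exists_le_abs_deviation (h : IsAdaptive P ν T A X)
    (hs : HasSubgaussianMGF (fun x => x - m) C (ν a)) (hC : 0 < C) {s M : ℝ} (hs0 : 0 ≤ s)
    (hM : 0 < M) :
    P {ω | ∃ t ≤ T, (pulls A a t ω : ℝ) ≤ M ∧ s ≤ |deviation A X a m t ω|} ≤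
      ENNReal.ofReal (2 * Real.exp (-(s ^ 2 / (2 * C * M)))) := by
  refine (measure_mono ?_).trans
    (h.measure_exists_abs_le_exp_neg hs (s / (C * M)) (s ^ 2 / (2 * C * M)))
  rintro ω ⟨t, ht, hN, hd⟩
  refine ⟨t, ht, ?_⟩
  calc s ^ 2 / (2 * C * M) = s / (C * M) * s - C * (s / (C * M)) ^ 2 / 2 * M := by
        field_simp; ring
    _ ≤ _ := by gcongr

theorem measure_exists_sqrt_half_log_le_abs_deviation (h : IsAdaptive P ν T A X)
    (hs : HasSubgaussianMGF (fun x => x - m) C (ν a)) (hC : 0 < C) {c M N : ℝ} (hc : 0 ≤ c)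
    (hM : 0 < M) (hMN : M ≤ N) :
    P {ω | ∃ t ≤ T, (pulls A a t ω : ℝ) ≤ M ∧
        c * √(M / 2 * Real.log (N / M)) ≤ |deviation A X a m t ω|} ≤
      ENNReal.ofReal (2 * (M / N) ^ (c ^ 2 / (4 * C))) := by
  have hN : 0 < N := hM.trans_le hMN
  have hlog : 0 ≤ Real.log (N / M) := Real.log_nonneg ((one_le_div hM).mpr hMN)
  refine (h.measure_exists_le_abs_deviation hs hC (by positivity) hM).trans_eq ?_
  rw [mul_pow, Real.sq_sqrt (by positivity), Real.rpow_def_of_pos (by positivity),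
    ← inv_div N M, Real.log_inv]
  congr 3
  field_simp
  ring

end IsAdaptive

theorem exists_mul_half_pow_log_le {n B N : ℝ} (hn : 0 < n) (hnB : n ≤ B) (hBN : B ≤ N) :
    ∃ i : ℕ, n ≤ B * (1 / 2) ^ i ∧
      B * (1 / 2) ^ i / 2 * Real.log (N / (B * (1 / 2) ^ i)) ≤ n * Real.log (N / n) := by
  have hB : 0 < B := hn.trans_le hnB
  obtain ⟨i, hlt, hle⟩ := exists_nat_pow_near_of_lt_one (x := n / B) (y := (1 / 2 : ℝ))
    (by positivity) ((div_le_one hB).mpr hnB) (by norm_num) (by norm_num)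
  rw [lt_div_iff₀ hB, pow_succ] at hlt
  rw [div_le_iff₀ hB, mul_comm] at hle
  have hblock : B * (1 / 2) ^ i ≤ N :=
    (mul_le_of_le_one_right hB.le (pow_le_one₀ (by norm_num) (by norm_num))).trans hBN
  refine ⟨i, hle, mul_le_mul (by linarith) ?_
    (Real.log_nonneg ((one_le_div (by positivity)).mpr hblock)) hn.le⟩
  have hN : 0 < N := hB.trans_le hBN
  gcongr

theorem IsAdaptive.measure_exists_sqrt_log_le_abs_deviation [MeasurableSpace Ω] {P : Measure Ω}
    [IsProbabilityMeasure P] {ν : Fin K → Measure ℝ} [∀ b, IsProbabilityMeasure (ν b)] {T : ℕ}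
    {a : Fin K} {m : ℝ} {C : ℝ≥0} (h : IsAdaptive P ν T A X)
    (hs : HasSubgaussianMGF (fun x => x - m) C (ν a)) (hC : 0 < C) {c B N : ℝ} (hc : 0 < c)
    (hB : 0 < B) (hBN : B ≤ N) :
    P {ω | ∃ t ≤ T, 0 < pulls A a t ω ∧ (pulls A a t ω : ℝ) ≤ B ∧
        c * √(pulls A a t ω * Real.log (N / pulls A a t ω)) ≤ |deviation A X a m t ω|} ≤
      ENNReal.ofReal (2 * (B / N) ^ (c ^ 2 / (4 * C)) * (1 - (1 / 2) ^ (c ^ 2 / (4 * C)))⁻¹) := by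
  set p : ℝ := c ^ 2 / (4 * C)
  have hN : 0 < N := hB.trans_le hBN
  have ratio_lt_one : (1 / 2 : ℝ) ^ p < 1 :=
    Real.rpow_lt_one (by norm_num) (by norm_num) (by positivity)
  have block (i : ℕ) := h.measure_exists_sqrt_half_log_le_abs_deviation hs hC hc.le
    (M := B * (1 / 2) ^ i) (by positivity)
    ((mul_le_of_le_one_right hB.le (pow_le_one₀ (by norm_num) (by norm_num))).trans hBN)
  have geometric (i : ℕ) : 2 * (B * (1 / 2) ^ i / N) ^ p = 2 * (B / N) ^ p * ((1 / 2) ^ p) ^ i := by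
    rw [mul_div_right_comm, Real.mul_rpow (by positivity) (by positivity), ← mul_assoc,
      ← Real.rpow_natCast, ← Real.rpow_natCast, ← Real.rpow_mul (by norm_num),
      ← Real.rpow_mul (by norm_num), mul_comm p]
  calc _ ≤ P (⋃ i : ℕ, {ω | ∃ t ≤ T, (pulls A a t ω : ℝ) ≤ B * (1 / 2) ^ i ∧
          c * √(B * (1 / 2) ^ i / 2 * Real.log (N / (B * (1 / 2) ^ i))) ≤
            |deviation A X a m t ω|}) := measure_mono <| by
        rintro ω ⟨t, ht, hpos, hle, hdev⟩
        obtain ⟨i, hi, hlog⟩ := exists_mul_half_pow_log_le (Nat.cast_pos.mpr hpos) hle hBN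
        exact Set.mem_iUnion.mpr ⟨i, t, ht, hi, le_trans (by gcongr) hdev⟩
    _ ≤ ∑' i : ℕ, ENNReal.ofReal (2 * (B / N) ^ p * ((1 / 2) ^ p) ^ i) :=
        (measure_iUnion_le _).trans (ENNReal.tsum_le_tsum fun i => geometric i ▸ block i)
    _ = ENNReal.ofReal (2 * (B / N) ^ p * (1 - (1 / 2) ^ p)⁻¹) := by
        rw [← ENNReal.ofReal_tsum_of_nonneg (fun i => by positivity)
          ((summable_geometric_of_lt_one (by positivity) ratio_lt_one).mul_left _),
          tsum_mul_left, tsum_geometric_of_lt_one (by positivity) ratio_lt_one]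

end Deviations

section Optimism

variable {Ω : Type*} {K : ℕ} {A : ℕ → Ω → Fin K} {X : ℕ → Ω → ℝ} {U : Index K} {T : ℕ} {ω : Ω}
  {m : Fin K → ℝ} {c N B : ℝ}

theorem FollowsIndex.pulls_pos (h : FollowsIndex U T A X) {t : ℕ} (hKt : K ≤ t) (htT : t ≤ T)
    (b : Fin K) (ω : Ω) : 0 < pulls A b t ω := by
  have hinit := h.init (hKt.trans htT) ω b
  exact Nat.one_pos.trans_le (hinit ▸ pulls_mono b ω hKt)

/-- Up to time `T`, the empirical mean of every arm that has been pulled `n ≤ B` times is within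
`c √(log (N / n) / n)` of `m`. -/
def IsConcentrated (A : ℕ → Ω → Fin K) (X : ℕ → Ω → ℝ) (m : Fin K → ℝ) (c N B : ℝ) (T : ℕ)
    (ω : Ω) : Prop :=
  ∀ b, ∀ t ≤ T, 0 < pulls A b t ω → (pulls A b t ω : ℝ) ≤ B →
    |empMean A X b t ω - m b| < c * √(Real.log (N / pulls A b t ω) / pulls A b t ω)

theorem sqrt_mul_log_le_abs_deviation_of_le (b : Fin K) {t : ℕ} (hpos : 0 < pulls A b t ω)
    (h : c * √(Real.log (N / pulls A b t ω) / pulls A b t ω) ≤ |empMean A X b t ω - m b|) :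
    c * √(pulls A b t ω * Real.log (N / pulls A b t ω)) ≤ |deviation A X b (m b) t ω| := by
  have hroot : √(pulls A b t ω * Real.log (N / pulls A b t ω)) =
      √(Real.log (N / pulls A b t ω) / pulls A b t ω) * pulls A b t ω := by
    have hn : (pulls A b t ω : ℝ) ≠ 0 := by positivity
    rw [show pulls A b t ω * Real.log (N / pulls A b t ω) =
      Real.log (N / pulls A b t ω) / pulls A b t ω * (pulls A b t ω : ℝ) ^ 2 by field_simp,
      Real.sqrt_mul' _ (sq_nonneg _), Real.sqrt_sq (Nat.cast_nonneg _)]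
  rw [abs_deviation, hroot, ← mul_assoc]
  gcongr

theorem IsAdaptive.measure_not_isConcentrated_le [MeasurableSpace Ω] {P : Measure Ω}
    [IsProbabilityMeasure P] {ν : Fin K → Measure ℝ} [∀ b, IsProbabilityMeasure (ν b)] {C : ℝ≥0}
    (h : IsAdaptive P ν T A X) (hs : ∀ b, HasSubgaussianMGF (fun x => x - m b) C (ν b))
    (hC : 0 < C) (hc : 0 < c) (hB : 0 < B) (hBN : B ≤ N) :
    P {ω | ¬ IsConcentrated A X m c N B T ω} ≤ K * ENNReal.ofReal
      (2 * (B / N) ^ (c ^ 2 / (4 * C)) * (1 - (1 / 2) ^ (c ^ 2 / (4 * C)))⁻¹) := by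
  have union : {ω | ¬ IsConcentrated A X m c N B T ω} ⊆
      ⋃ b, {ω | ∃ t ≤ T, 0 < pulls A b t ω ∧ (pulls A b t ω : ℝ) ≤ B ∧
        c * √(pulls A b t ω * Real.log (N / pulls A b t ω)) ≤ |deviation A X b (m b) t ω|} := by
    intro ω hω
    simp only [IsConcentrated, Set.mem_ofPred_eq, not_forall, not_lt] at hω
    obtain ⟨b, t, ht, hpos, hle, hdev⟩ := hω
    exact Set.mem_iUnion.mpr
      ⟨b, t, ht, hpos, hle, sqrt_mul_log_le_abs_deviation_of_le b hpos hdev⟩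
  refine (measure_mono union).trans ((measure_iUnion_fintype_le _ _).trans
    ((Finset.sum_le_sum fun b _ =>
      h.measure_exists_sqrt_log_le_abs_deviation (hs b) hC hc hB hBN).trans_eq ?_))
  rw [Finset.sum_const, Finset.card_univ, Fintype.card_fin, nsmul_eq_mul]

theorem exists_natCast_mul_ofReal_rpow_le (K : ℕ) (D : ℝ) {p M δ : ℝ} (hp : 0 < p) (hM : 0 < M)
    (hδ : 0 < δ) :
    ∃ x : ℝ, 0 < x ∧ x ≤ M ∧ K * ENNReal.ofReal (2 * x ^ p * D) ≤ ENNReal.ofReal δ := by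
  have hcont : ContinuousAt (fun x : ℝ => K * ENNReal.ofReal (2 * x ^ p * D)) 0 := by
    refine ENNReal.Tendsto.const_mul ?_ (.inr (ENNReal.natCast_ne_top K))
    exact (ENNReal.continuous_ofReal.continuousAt.comp (((Real.continuousAt_rpow_const 0 p
      (.inr hp.le)).const_mul 2).mul_const D))
  have hlim : Tendsto (fun x : ℝ => K * ENNReal.ofReal (2 * x ^ p * D)) (nhds 0) (nhds 0) := by
    simpa [ContinuousAt, Real.zero_rpow hp.ne'] using hcont
  obtain ⟨x, hxδ, hx, hxM⟩ := (((hlim.mono_left nhdsWithin_le_nhds).eventually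
    (eventually_le_nhds (ENNReal.ofReal_pos.mpr hδ))).and (Ioc_mem_nhdsGT hM)).exists
  exact ⟨x, hx, hxM, hxδ⟩

/-- For all bandits with arms of variance proxy `C`, with high probability, once a fraction `γ` of
the rounds has passed, the index of a best arm is at least the mean of that arm, unless the arm has
already been pulled in a fraction `κ` of the rounds. -/
def IsOptimistic (U : Index K) (C : ℝ≥0) : Prop :=
  ∀ γ δ : ℝ, 0 < γ → γ ≤ 1 → 0 < δ → ∃ κ : ℝ, 0 < κ ∧ ∃ T₀ : ℕ,
    ∀ (Ω : Type u) [MeasurableSpace Ω] (P : Measure Ω) [IsProbabilityMeasure P]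
      (ν : Fin K → Measure ℝ) [∀ b, IsProbabilityMeasure (ν b)] (T : ℕ) (A : ℕ → Ω → Fin K)
      (X : ℕ → Ω → ℝ) (m : Fin K → ℝ) (a : Fin K), T₀ ≤ T → IsAdaptive P ν T A X →
      FollowsIndex U T A X → (∀ b, HasSubgaussianMGF (fun x => x - m b) C (ν b)) →
      (∀ b, m b ≤ m a) →
      P {ω | ∃ t, K ≤ t ∧ γ * T ≤ t ∧ t < T ∧ (pulls A a t ω : ℝ) ≤ κ * T ∧
        indexAt U T A X a t ω < m a} ≤ ENNReal.ofReal δ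

theorem IsConcentrated.le_indexAt_of_anytimeMoss_le {a : Fin K} {γ : ℝ}
    (h : IsConcentrated A X m 1 (γ / K * T) B T ω) (hF : FollowsIndex U T A X) (hK : 0 < K)
    (hγ : 0 < γ) (hU : ∀ (T t : ℕ) (n : Fin K → ℕ) (m : Fin K → ℝ), (∀ j, 0 < n j) →
      n a ≤ t → t ≤ T → anytimeMoss K T t n m a ≤ U T t n m a)
    {t : ℕ} (hKt : K ≤ t) (hγt : γ * T ≤ t) (htT : t < T) (hn : (pulls A a t ω : ℝ) ≤ B) :
    m a ≤ indexAt U T A X a t ω := by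
  have hpos := (hF.pulls_pos hKt htT.le · ω)
  have : (0 : ℝ) < K := by exact_mod_cast hK
  have hT0 : (0 : ℝ) < T := by exact_mod_cast htT.pos
  have hna : (0 : ℝ) < pulls A a t ω := by exact_mod_cast hpos a
  have hmean := (abs_lt.mp (h a t htT.le (hpos a) hn)).1
  have hbonus : √(Real.log (γ / K * T / pulls A a t ω) / pulls A a t ω) ≤
      √(max 0 (Real.log (t / (K * pulls A a t ω))) / pulls A a t ω) := by
    gcongr
    refine le_max_of_le_right (Real.log_le_log (by positivity) ?_)
    rw [div_mul_eq_mul_div, div_div]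
    gcongr
  refine le_trans ?_ (hU T t (fun b => pulls A b t ω) (fun b => empMean A X b t ω) hpos
    (pulls_le a t ω) htT.le)
  simp only [anytimeMoss]
  linarith

theorem isOptimistic_of_anytimeMoss_le (hK : 0 < K) {C : ℝ≥0} (hC : 0 < C)
    (hU : ∀ (T t : ℕ) (n : Fin K → ℕ) (m : Fin K → ℝ) (b : Fin K), (∀ j, 0 < n j) →
      n b ≤ t → t ≤ T → anytimeMoss K T t n m b ≤ U T t n m b) :
    IsOptimistic.{u} U C := by
  intro γ δ hγ _ hδ
  obtain ⟨x, hx, hx1, hxδ⟩ := exists_natCast_mul_ofReal_rpow_le K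
    (1 - (1 / 2) ^ ((1 : ℝ) ^ 2 / (4 * C)))⁻¹ (p := 1 ^ 2 / (4 * C)) (by positivity) one_pos hδ
  refine ⟨x * (γ / K), by positivity, 1, fun Ω _ P _ ν _ T A X m a hT hA hF hs _ => ?_⟩
  have hN : 0 < γ / K * T := by positivity
  have hprob := hA.measure_not_isConcentrated_le hs hC one_pos (B := x * (γ / K * T))
    (by positivity) (mul_le_of_le_one_left hN.le hx1)
  rw [mul_div_cancel_right₀ _ hN.ne'] at hprob
  refine (measure_mono ?_).trans (hprob.trans hxδ)
  rintro ω ⟨t, hKt, hγt, htT, hn, hlt⟩ hconc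
  exact hlt.not_ge (hconc.le_indexAt_of_anytimeMoss_le hF hK hγ (fun T t n m => hU T t n m a)
    hKt hγt htT (hn.trans_eq (mul_assoc _ _ _)))

theorem exists_le_mul_pulls (hK : 0 < K) (s : ℕ) (ω : Ω) : ∃ b, s ≤ K * pulls A b s ω := by
  have : NeZero K := ⟨hK.ne'⟩
  obtain ⟨b, -, hb⟩ := Finset.exists_max_image Finset.univ (fun b => pulls A b s ω)
    Finset.univ_nonempty
  refine ⟨b, ?_⟩
  simpa [sum_pulls] using Finset.sum_le_card_nsmul Finset.univ _ _ hb

/-- An arm cannot be chosen once it has been pulled 16 times as often as a better arm, because its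
bonus is then at most a quarter of the bonus of the better arm. -/
theorem IsConcentrated.pulls_lt_of_ocUcb {η L : ℝ} (hη : -1 < η) (hL : 0 < L)
    (h : IsConcentrated A X m (√(2 * (1 + η)) / 2) (T / L) B T ω)
    (hF : FollowsIndex (ocUcb K η) T A X) {a b : Fin K} (hm : m b ≤ m a) {t : ℕ} (ht : 0 < t)
    (hKt : K ≤ t) (htT : t < T) (htB : (t : ℝ) ≤ B) (hchoice : A (t + 1) ω = b)
    (hta : (t : ℝ) ≤ L * pulls A a t ω) : pulls A b t ω < 16 * pulls A a t ω := by
  by_contra! hab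
  have hpos := (hF.pulls_pos hKt htT.le · ω)
  have hna : (0 : ℝ) < pulls A a t ω := by exact_mod_cast hpos a
  have hle : 16 * (pulls A a t ω : ℝ) ≤ pulls A b t ω := by exact_mod_cast hab
  have ht0 : (0 : ℝ) < t := by exact_mod_cast ht
  have hT0 : (0 : ℝ) < T := by exact_mod_cast htT.pos
  have hlog : 0 < Real.log (T / t) :=
    Real.log_pos ((one_lt_div ht0).mpr (by exact_mod_cast htT))
  have hroot : 0 < √(2 * (1 + η)) := Real.sqrt_pos.mpr (by linarith)
  have width (j : Fin K) (hj : (t : ℝ) ≤ L * pulls A j t ω) :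
      |empMean A X j t ω - m j| <
        √(2 * (1 + η)) / 2 * √(Real.log (T / t) / pulls A j t ω) := by
    have hnj : (0 : ℝ) < pulls A j t ω := by exact_mod_cast hpos j
    refine (h j t htT.le (hpos j) ((Nat.cast_le.mpr (pulls_le j t ω)).trans htB)).trans_le ?_
    rw [div_div]
    gcongr
  have bonus_ratio : √(Real.log (T / t) / pulls A b t ω) ≤
      √(Real.log (T / t) / pulls A a t ω) / 4 := by
    calc √(Real.log (T / t) / pulls A b t ω) ≤ √(Real.log (T / t) / (pulls A a t ω * 4 ^ 2)) := by
          gcongr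
          linarith
      _ = √(Real.log (T / t) / pulls A a t ω) / 4 := by
          rw [← div_div, Real.sqrt_div' _ (sq_nonneg 4), Real.sqrt_sq zero_le_four]
  have hopt := hF.optimism t hKt htT ω a
  have split (n : ℝ) : √(2 * (1 + η) / n * Real.log (T / t)) =
      √(2 * (1 + η)) * √(Real.log (T / t) / n) := by
    rw [← Real.sqrt_mul (by linarith), div_mul_eq_mul_div, mul_div_assoc]
  simp only [hchoice, indexAt, ocUcb, split] at hopt
  have hbonus : 0 < √(2 * (1 + η)) * √(Real.log (T / t) / pulls A a t ω) :=
    mul_pos hroot (Real.sqrt_pos.mpr (by positivity))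
  have lower := (abs_lt.mp (width a hta)).1
  have upper := (abs_lt.mp (width b (hta.trans (by gcongr; linarith)))).2
  linarith [mul_le_mul_of_nonneg_left bonus_ratio hroot.le]

theorem IsConcentrated.le_mul_pulls_of_ocUcb {η : ℝ} (hη : -1 < η) (hK : 0 < K)
    (h : IsConcentrated A X m (√(2 * (1 + η)) / 2) (T / (32 * K ^ 2)) B T ω)
    (hF : FollowsIndex (ocUcb K η) T A X) {a : Fin K} (hm : ∀ b, m b ≤ m a) {s : ℕ}
    (hKs : K ≤ s) (hsB : (s : ℝ) ≤ B) (hsT : s ≤ T) : s ≤ 32 * K ^ 2 * pulls A a s ω := by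
  induction s using Nat.strong_induction_on with
  | _ s ih =>
    by_contra! hlt
    have hpos := (hF.pulls_pos hKs hsT · ω)
    obtain ⟨b, hb⟩ := exists_le_mul_pulls (A := A) hK s ω
    obtain ⟨t, hts, hchoice, hlast⟩ := exists_last_pull (hpos b)
    have hs : 32 * K ^ 2 < s := (Nat.le_mul_of_pos_right _ (hpos a)).trans_lt hlt
    have hst : s ≤ 2 * K * pulls A b t ω := by rw [← hlast] at hb; nlinarith
    have hbt : pulls A b t ω ≤ t := pulls_le b t ω
    have hKt : K ≤ t := by nlinarith
    have htB : (t : ℝ) ≤ B := (Nat.cast_le.mpr hts.le).trans hsB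
    have hta := ih t hts hKt htB (hts.le.trans hsT)
    have hba := h.pulls_lt_of_ocUcb hη (by positivity) hF (hm b) (hK.trans_le hKt) hKt
      (hts.trans_le hsT) htB hchoice (by exact_mod_cast hta)
    refine hlt.not_ge ?_
    calc s ≤ 2 * K * pulls A b t ω := hst
      _ ≤ 2 * K * (16 * pulls A a t ω) := by gcongr
      _ ≤ 32 * K ^ 2 * pulls A a t ω := by nlinarith [Nat.zero_le (pulls A a t ω)]
      _ ≤ 32 * K ^ 2 * pulls A a s ω := by gcongr; exact pulls_mono a ω hts.le

theorem IsConcentrated.lt_pulls_of_ocUcb {η : ℝ} (hη : -1 < η) (hK : 0 < K)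
    (h : IsConcentrated A X m (√(2 * (1 + η)) / 2) (T / (32 * K ^ 2)) B T ω)
    (hF : FollowsIndex (ocUcb K η) T A X) {a : Fin K} (hm : ∀ b, m b ≤ m a) (hKB : K + 1 ≤ B)
    {t : ℕ} (hBt : B ≤ t) (htT : t ≤ T) : B / (128 * K ^ 2) < pulls A a t ω := by
  have hK1 : (1 : ℝ) ≤ K := by exact_mod_cast hK
  have hfloor : (⌊B⌋₊ : ℝ) ≤ B := Nat.floor_le (by linarith)
  have hst : ⌊B⌋₊ ≤ t := Nat.cast_le.mp (hfloor.trans hBt)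
  have hpulls : (⌊B⌋₊ : ℝ) ≤ 32 * K ^ 2 * pulls A a ⌊B⌋₊ ω := by
    exact_mod_cast h.le_mul_pulls_of_ocUcb hη hK hF hm (Nat.le_floor (by linarith)) hfloor
      (hst.trans htT)
  have hmono : (pulls A a ⌊B⌋₊ ω : ℝ) ≤ pulls A a t ω := Nat.cast_le.mpr (pulls_mono a ω hst)
  rw [div_lt_iff₀' (by positivity)]
  calc B < 4 * ⌊B⌋₊ := by linarith [Nat.lt_floor_add_one B]
    _ ≤ 4 * (32 * K ^ 2 * pulls A a t ω) := by
        gcongr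
        exact hpulls.trans (by gcongr)
    _ = 128 * K ^ 2 * pulls A a t ω := by ring

theorem isOptimistic_ocUcb {η : ℝ} (hη : -1 < η) (hK : 0 < K) {C : ℝ≥0} (hC : 0 < C) :
    IsOptimistic.{u} (ocUcb K η) C := by
  intro γ δ hγ _ hδ
  have hroot : 0 < √(2 * (1 + η)) := Real.sqrt_pos.mpr (by linarith)
  have hK0 : (0 : ℝ) < K := by exact_mod_cast hK
  set p : ℝ := (√(2 * (1 + η)) / 2) ^ 2 / (4 * C)
  obtain ⟨x, hx, hxM, hxδ⟩ := exists_natCast_mul_ofReal_rpow_le K (1 - (1 / 2) ^ p)⁻¹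
    (show 0 < p by positivity) (lt_min one_pos (show 0 < γ * (32 * K ^ 2) by positivity)) hδ
  set ε : ℝ := x / (32 * K ^ 2) with hε
  have hε0 : 0 < ε := by positivity
  have hεγ : ε ≤ γ := (div_le_iff₀ (by positivity)).mpr (hxM.trans (min_le_right _ _))
  refine ⟨ε / (128 * K ^ 2), by positivity, ⌈(K + 1) / ε⌉₊,
    fun Ω _ P _ ν _ T A X m a hT hA hF hs hm => ?_⟩
  have hεT : (K : ℝ) + 1 ≤ ε * T := (div_le_iff₀' hε0).mp (Nat.ceil_le.mp hT)
  have hT0 : (0 : ℝ) < T := pos_of_mul_pos_right (by linarith : 0 < ε * T) hε0.le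
  have hN : (0 : ℝ) < T / (32 * K ^ 2) := by positivity
  have hprob := hA.measure_not_isConcentrated_le hs hC (half_pos hroot)
    (B := x * (T / (32 * K ^ 2))) (by positivity)
    (mul_le_of_le_one_left hN.le (hxM.trans (min_le_left _ _)))
  rw [mul_div_cancel_right₀ _ hN.ne', ← mul_div_assoc, ← div_mul_eq_mul_div, ← hε] at hprob
  refine (measure_mono ?_).trans (hprob.trans hxδ)
  rintro ω ⟨t, -, hγt, htT, hn, -⟩ hconc
  refine hn.not_gt ?_
  rw [div_mul_eq_mul_div]
  exact hconc.lt_pulls_of_ocUcb hη hK hF hm hεT (le_trans (by gcongr) hγt) htT.le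

end Optimism

section LargeGap

variable {Ω : Type*} {K : ℕ} {A : ℕ → Ω → Fin K} {X : ℕ → Ω → ℝ} {U : Index K} {T : ℕ} {ω : Ω}
  {m : Fin K → ℝ} {a : Fin K} {c Δ γ κ : ℝ} {C : ℝ≥0}

/-- The bonus of `U` is nonnegative and at most `√(c log (T / n) / n)`, where `n` is the number of
pulls of the arm. -/
def HasLogBonus (U : Index K) (c : ℝ) : Prop :=
  ∀ (T t : ℕ) (n : Fin K → ℕ) (m : Fin K → ℝ) (b : Fin K), (∀ j, 0 < n j) → n b ≤ t → t ≤ T →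
    m b ≤ U T t n m b ∧ U T t n m b ≤ m b + √(c * Real.log (T / n b) / n b)

theorem HasLogBonus.indexAt_lt (hU : HasLogBonus U c) (hc : 0 ≤ c) (hF : FollowsIndex U T A X)
    (hΔ : 0 < Δ) (hγ : 0 < γ) (hΔT : 16 * (c * Real.log (1 / γ)) / γ ≤ Δ ^ 2 * T) {t : ℕ}
    (hKt : K ≤ t) (htT : t < T) {b : Fin K} (hn : γ * T ≤ pulls A b t ω)
    (hmean : |empMean A X b t ω - m b| < Δ / 4) : indexAt U T A X b t ω < m b + Δ / 2 := by
  have hpos := (hF.pulls_pos hKt htT.le · ω)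
  have hnb : (0 : ℝ) < pulls A b t ω := by exact_mod_cast hpos b
  have hT0 : (0 : ℝ) < T := by exact_mod_cast htT.pos
  have hbonus : √(c * Real.log (T / pulls A b t ω) / pulls A b t ω) ≤ Δ / 4 := by
    rw [Real.sqrt_le_left (by positivity), div_le_iff₀ hnb]
    calc c * Real.log (T / pulls A b t ω) ≤ c * Real.log (1 / γ) := by
          gcongr c * Real.log ?_
          rw [div_le_div_iff₀ hnb hγ]
          linarith
      _ ≤ (Δ / 4) ^ 2 * (γ * T) := by
          rw [div_le_iff₀ hγ] at hΔT
          linarith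
      _ ≤ (Δ / 4) ^ 2 * pulls A b t ω := by gcongr
  have hindex := (hU T t (fun b => pulls A b t ω) (fun b => empMean A X b t ω) b hpos
    (pulls_le b t ω) htT.le).2
  refine hindex.trans_lt ?_
  linarith [(abs_lt.mp hmean).2]

theorem exists_ne_le_pulls_add_mul_pulls {s : ℕ} (h : pulls A a s ω < s) :
    ∃ b ≠ a, s ≤ pulls A a s ω + K * pulls A b s ω := by
  have hsum := sum_pulls (A := A) s ω
  rw [← Finset.add_sum_erase _ _ (Finset.mem_univ a)] at hsum
  have hne : (Finset.univ.erase a).Nonempty := by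
    rw [Finset.nonempty_iff_ne_empty]
    intro hempty
    rw [hempty, Finset.sum_empty] at hsum
    omega
  obtain ⟨b, hb, hmax⟩ := Finset.exists_max_image _ (fun b => pulls A b s ω) hne
  refine ⟨b, Finset.ne_of_mem_erase hb, ?_⟩
  have hcard : (Finset.univ.erase a).card ≤ K := (Finset.card_le_univ _).trans (by simp)
  calc s = pulls A a s ω + ∑ b ∈ Finset.univ.erase a, pulls A b s ω := hsum.symm
    _ ≤ pulls A a s ω + (Finset.univ.erase a).card * pulls A b s ω := by
        gcongr
        simpa using Finset.sum_le_card_nsmul _ _ _ hmax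
    _ ≤ pulls A a s ω + K * pulls A b s ω := by gcongr

theorem exists_large_pulls_choice (hT : 20 * K ^ 2 ≤ T)
    (h : (pulls A a T ω : ℝ) < 9 / 10 * T) :
    ∃ b ≠ a, ∃ t, K ≤ t ∧ t < T ∧ A (t + 1) ω = b ∧ 1 / (20 * K) * (T : ℝ) ≤ pulls A b t ω := by
  have hK0 : 0 < K := a.pos
  have hT' : 20 * (K : ℝ) ^ 2 ≤ T := by exact_mod_cast hT
  have hlt : (pulls A a T ω : ℝ) < T := by linarith [(Nat.cast_nonneg T : (0 : ℝ) ≤ T)]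
  obtain ⟨b, hba, hb⟩ := exists_ne_le_pulls_add_mul_pulls (Nat.cast_lt.mp hlt)
  have hb' : (T : ℝ) < 10 * K * pulls A b T ω := by
    have : (T : ℝ) ≤ pulls A a T ω + K * pulls A b T ω := by exact_mod_cast hb
    linarith
  have hb0 : 0 < pulls A b T ω := by
    by_contra! hzero
    rw [Nat.le_zero.mp hzero, Nat.cast_zero, mul_zero] at hb'
    exact hb'.not_ge (Nat.cast_nonneg T)
  obtain ⟨t, htT, hchoice, hlast⟩ := exists_last_pull hb0
  rw [← hlast, Nat.cast_add_one] at hb'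
  have hK1 : (1 : ℝ) ≤ K := by exact_mod_cast hK0
  have hn : 1 / (20 * K) * (T : ℝ) ≤ pulls A b t ω := by
    rw [one_div_mul_eq_div, div_le_iff₀ (by positivity)]
    nlinarith
  have hKn : (K : ℝ) ≤ 1 / (20 * K) * T := by
    rw [one_div_mul_eq_div, le_div_iff₀ (by positivity)]
    linarith
  exact ⟨b, hba, t, (Nat.cast_le.mp (hKn.trans hn)).trans (pulls_le b t ω), htT, hchoice, hn⟩

/-- At a late choice of some arm `b ≠ a`, the index of `b` is below the midpoint between the means
of `b` and `a`, and the index of `a` is above it. -/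
theorem HasLogBonus.le_pulls (hU : HasLogBonus U c) (hc : 0 ≤ c) (hF : FollowsIndex U T A X)
    (hΔ : 0 < Δ) (hgap : ∀ b ≠ a, m b + Δ ≤ m a) (hγ : γ = 1 / (20 * K)) (hT : 20 * K ^ 2 ≤ T)
    (hΔT : 16 * (c * Real.log (1 / γ)) / γ ≤ Δ ^ 2 * T)
    (hopt : ∀ t, K ≤ t → γ * T ≤ t → t < T → (pulls A a t ω : ℝ) ≤ κ * T →
      m a ≤ indexAt U T A X a t ω)
    (hmean : ∀ b, ∀ t ≤ T, 0 < pulls A b t ω → min γ κ * T ≤ pulls A b t ω →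
      |empMean A X b t ω - m b| < Δ / 4) : 9 / 10 * (T : ℝ) ≤ pulls A a T ω := by
  by_contra! hlt
  obtain ⟨b, hba, t, hKt, htT, hchoice, hn⟩ := exists_large_pulls_choice hT hlt
  rw [← hγ] at hn
  have hγ0 : 0 < γ := hγ ▸ one_div_pos.mpr (mul_pos (by norm_num) (Nat.cast_pos.mpr a.pos))
  have hpos := (hF.pulls_pos hKt htT.le · ω)
  have index_b : indexAt U T A X b t ω < m b + Δ / 2 :=
    hU.indexAt_lt hc hF hΔ hγ0 hΔT hKt htT hn (hmean b t htT.le (hpos b)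
      (le_trans (by gcongr; exact min_le_left _ _) hn))
  have index_a : m a - Δ / 2 < indexAt U T A X a t ω := by
    by_cases hna : (pulls A a t ω : ℝ) ≤ κ * T
    · linarith [hopt t hKt (hn.trans (Nat.cast_le.mpr (pulls_le b t ω))) htT hna]
    · refine lt_of_lt_of_le ?_ (hU T t (fun b => pulls A b t ω) (fun b => empMean A X b t ω) a
        hpos (pulls_le a t ω) htT.le).1
      have := hmean a t htT.le (hpos a)
        (le_trans (by gcongr; exact min_le_right _ _) (not_le.mp hna).le)
      linarith [(abs_lt.mp this).1]
  have hmax := hF.optimism t hKt htT ω a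
  rw [hchoice] at hmax
  linarith [hgap b hba]

theorem IsAdaptive.measure_exists_le_abs_empMean_sub_le [MeasurableSpace Ω] {P : Measure Ω}
    [IsProbabilityMeasure P] {ν : Fin K → Measure ℝ} [∀ b, IsProbabilityMeasure (ν b)]
    (h : IsAdaptive P ν T A X) (hs : ∀ b, HasSubgaussianMGF (fun x => x - m b) C (ν b))
    (hC : 0 < C) (hK : 0 < K) (hΔ : 0 < Δ) {β : ℝ} (hβ : 0 < β)
    (hΔT : 256 * C * K / β ≤ Δ ^ 2 * T) :
    P {ω | ∃ b, ∃ t ≤ T, β * T ≤ pulls A b t ω ∧ Δ / 4 ≤ |empMean A X b t ω - m b|} ≤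
      ENNReal.ofReal (1 / 4) := by
  have arm (b : Fin K) : P {ω | ∃ t ≤ T, β * T ≤ pulls A b t ω ∧
      Δ / 4 * pulls A b t ω ≤ |deviation A X b (m b) t ω|} ≤ ENNReal.ofReal (1 / (4 * K)) := by
    refine (h.measure_exists_mul_pulls_le_abs_deviation (hs b) hC (by positivity) (β * T)).trans
      (ENNReal.ofReal_le_ofReal ?_)
    have hexponent : 8 * K ≤ (Δ / 4) ^ 2 * (β * T) / (2 * C) := by
      rw [le_div_iff₀ (by positivity)]
      rw [div_le_iff₀ hβ] at hΔT
      linarith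
    rw [Real.exp_neg, ← div_eq_mul_inv, div_le_div_iff₀ (Real.exp_pos _) (by positivity)]
    linarith [Real.add_one_le_exp ((Δ / 4) ^ 2 * (β * T) / (2 * C))]
  have union : {ω | ∃ b, ∃ t ≤ T, β * T ≤ pulls A b t ω ∧ Δ / 4 ≤ |empMean A X b t ω - m b|} ⊆
      ⋃ b, {ω | ∃ t ≤ T, β * T ≤ pulls A b t ω ∧
        Δ / 4 * pulls A b t ω ≤ |deviation A X b (m b) t ω|} := by
    rintro ω ⟨b, t, ht, hn, hdev⟩
    refine Set.mem_iUnion.mpr ⟨b, t, ht, hn, ?_⟩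
    rw [abs_deviation]
    gcongr
  calc _ ≤ ∑ b : Fin K, ENNReal.ofReal (1 / (4 * K)) :=
        (measure_mono union).trans ((measure_iUnion_fintype_le _ _).trans
          (Finset.sum_le_sum fun b _ => arm b))
    _ = ENNReal.ofReal (1 / 4) := by
        rw [← ENNReal.ofReal_sum_of_nonneg fun _ _ => by positivity, Finset.sum_const,
          Finset.card_univ, Fintype.card_fin, nsmul_eq_mul]
        field_simp

theorem half_le_measure_of_compl_le [MeasurableSpace Ω] {P : Measure Ω} [IsProbabilityMeasure P]
    {S : Set Ω} (h : P Sᶜ ≤ 1 / 2) : 1 / 2 ≤ P S := by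
  rw [one_div] at h ⊢
  rw [← ENNReal.one_sub_inv_two, tsub_le_iff_right]
  calc 1 = P (S ∪ Sᶜ) := by rw [Set.union_compl_self, measure_univ]
    _ ≤ P S + P Sᶜ := measure_union_le _ _
    _ ≤ P S + 2⁻¹ := by gcongr

theorem exists_half_le_measure_pulls (hK : 0 < K) (hc : 0 ≤ c) (hC : 0 < C)
    (hU : HasLogBonus U c) (hopt : IsOptimistic.{u} U C) :
    ∃ D : ℝ, 0 < D ∧ ∃ T₀ : ℕ, ∀ (Ω : Type u) [MeasurableSpace Ω] (P : Measure Ω)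
      [IsProbabilityMeasure P] (ν : Fin K → Measure ℝ) [∀ b, IsProbabilityMeasure (ν b)] (T : ℕ)
      (A : ℕ → Ω → Fin K) (X : ℕ → Ω → ℝ) (m : Fin K → ℝ) (a : Fin K) (Δ : ℝ), T₀ ≤ T →
      IsAdaptive P ν T A X → FollowsIndex U T A X →
      (∀ b, HasSubgaussianMGF (fun x => x - m b) C (ν b)) → 0 < Δ → D ≤ Δ ^ 2 * T →
      (∀ b ≠ a, m b + Δ ≤ m a) →
      1 / 2 ≤ P {ω | 9 / 10 * (T : ℝ) ≤ pulls A a T ω} := by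
  set γ : ℝ := 1 / (20 * K) with hγ_def
  have hγ : 0 < γ := by positivity
  have hγ1 : γ ≤ 1 := by
    rw [hγ_def, div_le_one (by positivity)]
    exact_mod_cast (by omega : 1 ≤ 20 * K)
  obtain ⟨κ, hκ, T₁, hT₁⟩ := hopt γ (1 / 4) hγ hγ1 (by norm_num)
  have hβ : 0 < min γ κ := lt_min hγ hκ
  have hbonus : 0 ≤ 16 * (c * Real.log (1 / γ)) / γ :=
    div_nonneg (mul_nonneg (by norm_num) (mul_nonneg hc
      (Real.log_nonneg ((one_le_div hγ).mpr hγ1)))) hγ.le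
  have hdev : 0 < 256 * C * K / min γ κ := by positivity
  refine ⟨_, add_pos_of_nonneg_of_pos hbonus hdev, max T₁ (20 * K ^ 2),
    fun Ω _ P _ ν _ T A X m a Δ hT hA hF hs hΔ hD hgap => ?_⟩
  have hle (b : Fin K) : m b ≤ m a := by
    rcases eq_or_ne b a with rfl | hb
    · exact le_rfl
    · linarith [hgap b hb]
  have cover : {ω | 9 / 10 * (T : ℝ) ≤ pulls A a T ω}ᶜ ⊆
      {ω | ∃ t, K ≤ t ∧ γ * T ≤ t ∧ t < T ∧ (pulls A a t ω : ℝ) ≤ κ * T ∧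
        indexAt U T A X a t ω < m a} ∪
      {ω | ∃ b, ∃ t ≤ T, min γ κ * T ≤ pulls A b t ω ∧ Δ / 4 ≤ |empMean A X b t ω - m b|} := by
    intro ω hfew
    by_contra! hgood
    simp only [Set.mem_union, Set.mem_ofPred_eq, not_or, not_exists, not_and, not_lt,
      not_le] at hgood
    exact hfew (hU.le_pulls hc hF hΔ hgap hγ_def ((le_max_right _ _).trans hT)
      (by linarith) hgood.1 fun b t ht _ => hgood.2 b t ht)
  refine half_le_measure_of_compl_le ?_
  calc _ ≤ ENNReal.ofReal (1 / 4) + ENNReal.ofReal (1 / 4) :=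
        (measure_mono cover).trans ((measure_union_le _ _).trans (add_le_add
          (hT₁ Ω P ν T A X m a ((le_max_left _ _).trans hT) hA hF hs hle)
          (hA.measure_exists_le_abs_empMean_sub_le hs hC hK hΔ hβ (by linarith))))
    _ = 1 / 2 := by
        rw [← ENNReal.ofReal_add (by norm_num) (by norm_num),
          show (1 / 4 + 1 / 4 : ℝ) = 1 / 2 by norm_num, ENNReal.ofReal_div_of_pos two_pos,
          ENNReal.ofReal_one, ENNReal.ofReal_ofNat]

end LargeGap

section Reweighting

variable {Ω : Type*} [MeasurableSpace Ω] {ν ρ : Measure Ω} {X : Ω → ℝ} {c B : ℝ≥0}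

theorem exp_mul_integral_le_mgf [IsProbabilityMeasure ρ] {l : ℝ} (hX : Integrable X ρ)
    (hexp : Integrable (fun x => Real.exp (l * X x)) ρ) :
    Real.exp (l * ∫ x, X x ∂ρ) ≤ mgf X ρ l := by
  rw [← integral_const_mul]
  exact convexOn_exp.map_integral_le Real.continuous_exp.continuousOn isClosed_univ
    (ae_of_all _ fun _ => Set.mem_univ _) (hX.const_mul l) hexp

variable [IsProbabilityMeasure ν] [IsProbabilityMeasure ρ]

theorem one_le_of_le_smul (hρ : ρ ≤ B • ν) : 1 ≤ B := by
  simpa using hρ Set.univ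

theorem integral_cosh_le_of_le_smul (hX : HasSubgaussianMGF X c ν) (hρ : ρ ≤ B • ν) (l : ℝ) :
    ∫ x, Real.cosh (l * X x) ∂ρ ≤ Real.exp (B * c * l ^ 2 / 2) := by
  have hcosh : Integrable (fun x => Real.cosh (l * X x)) ν := by
    simp only [Real.cosh_eq, ← neg_mul]
    exact ((hX.integrable_exp_mul l).add (hX.integrable_exp_mul (-l))).div_const 2
  have hle : ∫ x, Real.cosh (l * X x) ∂ν ≤ Real.exp (c * l ^ 2 / 2) := by
    have h1 := hX.mgf_le l
    have h2 := hX.mgf_le (-l)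
    simp only [mgf, neg_sq] at h1 h2
    simp only [Real.cosh_eq, ← neg_mul]
    rw [integral_div, integral_add (hX.integrable_exp_mul l) (hX.integrable_exp_mul (-l))]
    linarith
  have hsub : Integrable (fun x => Real.cosh (l * X x) - 1) (B • ν) :=
    (hcosh.sub (integrable_const 1)).smul_measure_nnreal
  calc ∫ x, Real.cosh (l * X x) ∂ρ = 1 + ∫ x, (Real.cosh (l * X x) - 1) ∂ρ := by
        rw [integral_sub (hcosh.smul_measure_nnreal.mono_measure hρ) (integrable_const 1)]
        simp
    _ ≤ 1 + ∫ x, (Real.cosh (l * X x) - 1) ∂(B • ν) := by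
        gcongr
        exact ae_of_all _ fun x => sub_nonneg.mpr (Real.one_le_cosh (l * X x))
    _ = 1 + B * (∫ x, Real.cosh (l * X x) ∂ν - 1) := by
        rw [integral_smul_nnreal_measure, integral_sub hcosh (integrable_const 1)]
        simp [NNReal.smul_def]
    _ ≤ 1 + B * (Real.exp (c * l ^ 2 / 2) - 1) := by gcongr
    _ ≤ (1 + (Real.exp (c * l ^ 2 / 2) - 1)) ^ (B : ℝ) :=
        one_add_mul_self_le_rpow_one_add (by linarith [Real.exp_pos (c * l ^ 2 / 2)])
          (one_le_of_le_smul hρ)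
    _ = Real.exp (B * c * l ^ 2 / 2) := by
        rw [add_sub_cancel, ← Real.exp_mul]
        ring_nf

-- Symmetrization: `exp (-l 𝔼X) * mgf l ≤ mgf (-l) * mgf l`, bounded by AM-GM through `cosh`, which
-- unlike `exp` stays above its value at `0`.
theorem hasSubgaussianMGF_sub_integral_of_le_smul (hX : HasSubgaussianMGF X c ν)
    (hρ : ρ ≤ B • ν) : HasSubgaussianMGF (fun x => X x - ∫ y, X y ∂ρ) (2 * B * c) ρ := by
  have hint : ∀ {f : Ω → ℝ}, Integrable f ν → Integrable f ρ := fun hf =>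
    hf.smul_measure_nnreal.mono_measure hρ
  have hexp : ∀ l, Integrable (fun x => Real.exp (l * X x)) ρ := fun l =>
    hint (hX.integrable_exp_mul l)
  have hfactor : ∀ l x, Real.exp (l * (X x - ∫ y, X y ∂ρ)) =
      Real.exp (-l * ∫ y, X y ∂ρ) * Real.exp (l * X x) := fun l x => by
    rw [← Real.exp_add]
    ring_nf
  refine ⟨fun l => by simpa only [hfactor] using (hexp l).const_mul _, fun l => ?_⟩
  have hcosh : (mgf X ρ (-l) + mgf X ρ l) / 2 = ∫ x, Real.cosh (l * X x) ∂ρ := by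
    simp only [Real.cosh_eq, ← neg_mul]
    rw [integral_div, integral_add (hexp l) (hexp (-l)), add_comm]
    rfl
  calc mgf (fun x => X x - ∫ y, X y ∂ρ) ρ l
      = Real.exp (-l * ∫ y, X y ∂ρ) * mgf X ρ l := by
        simp only [mgf, hfactor, integral_const_mul]
    _ ≤ mgf X ρ (-l) * mgf X ρ l := by
        gcongr
        · exact mgf_nonneg
        · exact exp_mul_integral_le_mgf (hint hX.integrable) (hexp (-l))
    _ ≤ ((mgf X ρ (-l) + mgf X ρ l) / 2) ^ 2 := by
        nlinarith [sq_nonneg (mgf X ρ (-l) - mgf X ρ l)]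
    _ ≤ Real.exp (B * c * l ^ 2 / 2) ^ 2 := by
        rw [hcosh]
        have : 0 ≤ ∫ x, Real.cosh (l * X x) ∂ρ :=
          integral_nonneg_of_ae (ae_of_all _ fun x => (Real.cosh_pos (l * X x)).le)
        gcongr
        exact integral_cosh_le_of_le_smul hX hρ l
    _ = Real.exp ((2 * B * c : ℝ≥0) * l ^ 2 / 2) := by
        rw [← Real.exp_nat_mul]
        push_cast
        ring_nf

end Reweighting

section Tilting

variable {ν : Measure ℝ}

/-- The score of the one-parameter family `tilt`: the centered indicator of the rewards above the
mean of `ν`. -/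
noncomputable def score (ν : Measure ℝ) (x : ℝ) : ℝ :=
  (Set.Ioi (∫ y, y ∂ν)).indicator 1 x - ν.real (Set.Ioi (∫ y, y ∂ν))

/-- The density `1 + θ * score ν` of the perturbed reward law; it is nonnegative, so that
`ENNReal.ofReal` does not truncate it, for `|θ| ≤ 1`. -/
noncomputable def tilt (ν : Measure ℝ) (θ x : ℝ) : ℝ≥0∞ :=
  ENNReal.ofReal (1 + θ * score ν x)

/-- The rate at which the mean of the perturbed reward law grows with `θ`. -/
noncomputable def tiltRate (ν : Measure ℝ) : ℝ :=
  ∫ x, (x - ∫ y, y ∂ν) * score ν x ∂ν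

theorem measurable_score : Measurable (score ν) :=
  (measurable_one.indicator measurableSet_Ioi).sub_const _

theorem measurable_tilt (θ : ℝ) : Measurable (tilt ν θ) :=
  ((measurable_score.const_mul θ).const_add 1).ennreal_ofReal

variable [IsProbabilityMeasure ν]

theorem abs_score_le (x : ℝ) : |score ν x| ≤ 1 := by
  have h0 : 0 ≤ ν.real (Set.Ioi (∫ y, y ∂ν)) := measureReal_nonneg
  have h1 : ν.real (Set.Ioi (∫ y, y ∂ν)) ≤ 1 := measureReal_le_one
  rw [score, abs_le]
  by_cases h : x ∈ Set.Ioi (∫ y, y ∂ν)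
  · simp only [Set.indicator_of_mem h, Pi.one_apply]
    constructor <;> linarith
  · simp only [Set.indicator_of_notMem h]
    constructor <;> linarith

theorem integrable_score : Integrable (score ν) ν :=
  .of_bound measurable_score.aestronglyMeasurable 1 (ae_of_all _ abs_score_le)

theorem integral_score : ∫ x, score ν x ∂ν = 0 := by
  have h : Integrable ((Set.Ioi (∫ y, y ∂ν)).indicator (1 : ℝ → ℝ)) ν :=
    (integrable_const 1).indicator measurableSet_Ioi
  simp only [score]
  rw [integral_sub h (integrable_const _), integral_indicator_one measurableSet_Ioi]
  simp

theorem integral_sub_integral (hint : Integrable (fun x => x - ∫ y, y ∂ν) ν) :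
    ∫ x, (x - ∫ y, y ∂ν) ∂ν = 0 := by
  have hid : Integrable (fun x : ℝ => x) ν :=
    (hint.add (integrable_const (∫ y, y ∂ν))).congr (ae_of_all _ fun x => sub_add_cancel x _)
  rw [integral_sub hid (integrable_const _)]
  simp

theorem not_ae_sub_integral_eq_zero (hvar : 0 < variance (fun x => x) ν) :
    ¬ (fun x => x - ∫ y, y ∂ν) =ᵐ[ν] 0 := by
  refine fun h => hvar.ne' ?_
  have hconst : (fun x => x) =ᵐ[ν] fun _ => ∫ y, y ∂ν := h.mono fun x hx => sub_eq_zero.mp hx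
  rw [variance_congr hconst, variance_eq_integral aemeasurable_const]
  simp

theorem proxy_pos_of_variance_pos {c : ℝ≥0}
    (hsub : HasSubgaussianMGF (fun x => x - ∫ y, y ∂ν) c ν)
    (hvar : 0 < variance (fun x => x) ν) : 0 < c := by
  refine pos_iff_ne_zero.mpr fun hc => not_ae_sub_integral_eq_zero hvar ?_
  subst hc
  exact hsub.ae_eq_zero_of_hasSubgaussianMGF_zero

theorem tiltRate_pos (hint : Integrable (fun x => x - ∫ y, y ∂ν) ν)
    (hvar : 0 < variance (fun x => x) ν) : 0 < tiltRate ν := by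
  set μ := ∫ y, y ∂ν with hμ
  have hpoint : ∀ x, (x - μ) * score ν x =
      |x - μ| / 2 + (1 / 2 - ν.real (Set.Ioi μ)) * (x - μ) := fun x => by
    rw [score, ← hμ]
    by_cases h : x ∈ Set.Ioi μ
    · rw [Set.indicator_of_mem h, abs_of_pos (sub_pos.mpr h), Pi.one_apply]
      ring
    · rw [Set.indicator_of_notMem h, abs_of_nonpos (sub_nonpos.mpr (not_lt.mp h))]
      ring
  have hrate : tiltRate ν = (∫ x, |x - μ| ∂ν) / 2 := by
    rw [tiltRate, ← hμ]
    simp_rw [hpoint]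
    rw [integral_add (hint.abs.div_const 2) (hint.const_mul _), integral_const_mul,
      integral_sub_integral hint, mul_zero, add_zero, integral_div]
  rw [hrate]
  refine half_pos ((integral_nonneg fun x => abs_nonneg _).lt_of_ne fun h =>
    not_ae_sub_integral_eq_zero hvar ?_)
  have hzero := (integral_eq_zero_iff_of_nonneg (fun x => abs_nonneg (x - μ)) hint.abs).mp h.symm
  exact hzero.mono fun x hx => abs_eq_zero.mp hx

variable {θ : ℝ}

theorem abs_mul_score_le (hθ : |θ| ≤ 1) (x : ℝ) : |θ * score ν x| ≤ 1 := by
  rw [abs_mul]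
  exact mul_le_one₀ hθ (abs_nonneg _) (abs_score_le x)

theorem one_add_mul_score_nonneg (hθ : |θ| ≤ 1) (x : ℝ) : 0 ≤ 1 + θ * score ν x := by
  linarith [(abs_le.mp (abs_mul_score_le (ν := ν) hθ x)).1]

theorem tilt_le_two (hθ : |θ| ≤ 1) (x : ℝ) : tilt ν θ x ≤ 2 := by
  rw [tilt, ← ENNReal.ofReal_ofNat]
  exact ENNReal.ofReal_le_ofReal (by linarith [(abs_le.mp (abs_mul_score_le (ν := ν) hθ x)).2])

theorem lintegral_tilt (hθ : |θ| ≤ 1) : ∫⁻ x, tilt ν θ x ∂ν = 1 := by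
  have hint : Integrable (fun x => 1 + θ * score ν x) ν :=
    (integrable_const 1).add (integrable_score.const_mul θ)
  simp only [tilt]
  rw [← ofReal_integral_eq_lintegral_ofReal hint (ae_of_all _ (one_add_mul_score_nonneg hθ)),
    integral_add (integrable_const 1) (integrable_score.const_mul θ), integral_const_mul,
    integral_score]
  simp

theorem isProbabilityMeasure_withDensity_tilt (hθ : |θ| ≤ 1) :
    IsProbabilityMeasure (ν.withDensity (tilt ν θ)) :=
  ⟨by rw [withDensity_apply _ .univ, Measure.restrict_univ, lintegral_tilt hθ]⟩

theorem withDensity_tilt_le (hθ : |θ| ≤ 1) : ν.withDensity (tilt ν θ) ≤ (2 : ℝ≥0) • ν := by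
  refine (withDensity_mono (ae_of_all _ (tilt_le_two hθ))).trans_eq ?_
  rw [withDensity_const]
  rfl

theorem lintegral_tilt_sq_le (hθ : |θ| ≤ 1) :
    ∫⁻ x, tilt ν θ x ^ 2 ∂ν ≤ ENNReal.ofReal (1 + θ ^ 2) := by
  have hle : ∀ x, (1 + θ * score ν x) ^ 2 ≤ (1 + θ ^ 2) + 2 * θ * score ν x := fun x => by
    have h : score ν x ^ 2 ≤ 1 := (sq_le_one_iff_abs_le_one _).mpr (abs_score_le x)
    linarith [mul_le_mul_of_nonneg_left h (sq_nonneg θ)]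
  calc ∫⁻ x, tilt ν θ x ^ 2 ∂ν
      ≤ ∫⁻ x, ENNReal.ofReal ((1 + θ ^ 2) + 2 * θ * score ν x) ∂ν := by
        refine lintegral_mono fun x => ?_
        rw [tilt, ← ENNReal.ofReal_pow (one_add_mul_score_nonneg hθ x)]
        exact ENNReal.ofReal_le_ofReal (hle x)
    _ = ENNReal.ofReal (∫ x, ((1 + θ ^ 2) + 2 * θ * score ν x) ∂ν) :=
        (ofReal_integral_eq_lintegral_ofReal
          ((integrable_const _).add (integrable_score.const_mul _))
          (ae_of_all _ fun x => (sq_nonneg _).trans (hle x))).symm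
    _ = ENNReal.ofReal (1 + θ ^ 2) := by
        rw [integral_add (integrable_const _) (integrable_score.const_mul _),
          integral_const_mul, integral_score]
        simp

theorem integral_withDensity_tilt (hint : Integrable (fun x => x - ∫ y, y ∂ν) ν)
    (hθ : |θ| ≤ 1) :
    ∫ x, (x - ∫ y, y ∂ν) ∂(ν.withDensity (tilt ν θ)) = θ * tiltRate ν := by
  have hscore : Integrable (fun x => (x - ∫ y, y ∂ν) * score ν x) ν :=
    hint.mul_bdd measurable_score.aestronglyMeasurable (ae_of_all _ abs_score_le)
  rw [integral_withDensity_eq_integral_toReal_smul (measurable_tilt θ)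
    (ae_of_all _ fun x => ENNReal.ofReal_lt_top)]
  calc ∫ x, (tilt ν θ x).toReal • (x - ∫ y, y ∂ν) ∂ν
      = ∫ x, ((x - ∫ y, y ∂ν) + θ * ((x - ∫ y, y ∂ν) * score ν x)) ∂ν := by
        refine integral_congr_ae (ae_of_all _ fun x => ?_)
        simp only [tilt, ENNReal.toReal_ofReal (one_add_mul_score_nonneg hθ x), smul_eq_mul]
        ring
    _ = θ * tiltRate ν := by
        rw [integral_add hint (hscore.const_mul θ), integral_const_mul,
          integral_sub_integral hint, zero_add, tiltRate]

theorem hasSubgaussianMGF_withDensity_tilt {c : ℝ≥0}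
    (hsub : HasSubgaussianMGF (fun x => x - ∫ y, y ∂ν) c ν) (hθ : |θ| ≤ 1) :
    HasSubgaussianMGF (fun x => x - (∫ y, y ∂ν + θ * tiltRate ν)) (2 * 2 * c)
      (ν.withDensity (tilt ν θ)) := by
  have := isProbabilityMeasure_withDensity_tilt (ν := ν) hθ
  simpa only [integral_withDensity_tilt hsub.integrable hθ, sub_sub] using
    hasSubgaussianMGF_sub_integral_of_le_smul hsub (withDensity_tilt_le hθ)

end Tilting

section Instability

theorem IsAdaptive.ofReal_exp_div_four_le_measure {Ω : Type*} [MeasurableSpace Ω] {K : ℕ}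
    {P : Measure Ω} [IsProbabilityMeasure P] {ν : Fin K → Measure ℝ} {T : ℕ}
    {A : ℕ → Ω → Fin K} {X : ℕ → Ω → ℝ} (h : IsAdaptive P ν T A X) {G : Fin K → ℝ → ℝ≥0∞}
    (hG : ∀ a, Measurable (G a)) {θ : ℝ}
    (hG2 : ∀ a, ∫⁻ x, G a x ^ 2 ∂(ν a) ≤ ENNReal.ofReal (1 + θ ^ 2)) {S : Set Ω}
    (hS : 1 / 2 ≤ P.withDensity (likelihood G A X T) S) :
    ENNReal.ofReal (Real.exp (-(θ ^ 2 * T)) / 4) ≤ P S := by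
  have hpow : (1 + θ ^ 2) ^ T ≤ Real.exp (θ ^ 2 * T) := by
    rw [mul_comm, Real.exp_nat_mul]
    gcongr
    linarith [Real.add_one_le_exp (θ ^ 2)]
  have hsq : (1 / 2 : ℝ≥0∞) ^ 2 ≤ ENNReal.ofReal (Real.exp (θ ^ 2 * T)) * P S :=
    calc (1 / 2 : ℝ≥0∞) ^ 2 ≤ (P.withDensity (likelihood G A X T) S) ^ 2 := by gcongr
      _ ≤ ENNReal.ofReal (1 + θ ^ 2) ^ T * P S := h.sq_withDensity_likelihood_le hG hG2 S
      _ ≤ ENNReal.ofReal (Real.exp (θ ^ 2 * T)) * P S := by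
        rw [← ENNReal.ofReal_pow (by positivity)]
        gcongr
  have hquarter : ENNReal.ofReal (1 / 4) = (1 / 2) ^ 2 := by
    rw [show (1 / 4 : ℝ) = (1 / 2) ^ 2 by norm_num, ENNReal.ofReal_pow (by norm_num),
      ENNReal.ofReal_div_of_pos two_pos, ENNReal.ofReal_one, ENNReal.ofReal_ofNat]
  calc ENNReal.ofReal (Real.exp (-(θ ^ 2 * T)) / 4)
      = ENNReal.ofReal (Real.exp (-(θ ^ 2 * T))) * (1 / 2) ^ 2 := by
        rw [← hquarter, ← ENNReal.ofReal_mul (Real.exp_nonneg _), mul_one_div]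
    _ ≤ ENNReal.ofReal (Real.exp (-(θ ^ 2 * T))) *
          (ENNReal.ofReal (Real.exp (θ ^ 2 * T)) * P S) := by gcongr
    _ = P S := by
        rw [← mul_assoc, ← ENNReal.ofReal_mul (Real.exp_nonneg _), ← Real.exp_add,
          neg_add_cancel, Real.exp_zero, ENNReal.ofReal_one, one_mul]

variable {K : ℕ} {ν : Measure ℝ} [IsProbabilityMeasure ν] {U : Index K} {b : ℝ} {c : ℝ≥0}

theorem IsAdaptive.exists_isAdaptive_raise_arm {Ω : Type*} [MeasurableSpace Ω] {P : Measure Ω}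
    [IsProbabilityMeasure P] {T : ℕ} {A : ℕ → Ω → Fin K} {X : ℕ → Ω → ℝ}
    (h : IsAdaptive P (fun _ => ν) T A X)
    (hsub : HasSubgaussianMGF (fun x => x - ∫ y, y ∂ν) c ν) (a : Fin K) {θ : ℝ} (hθ : |θ| ≤ 1) :
    ∃ Q : Measure Ω, IsProbabilityMeasure Q ∧ ∃ ρ : Fin K → Measure ℝ,
      (∀ j, IsProbabilityMeasure (ρ j)) ∧ IsAdaptive Q ρ T A X ∧
      (∀ j, HasSubgaussianMGF
        (fun x => x - (∫ y, y ∂ν + if j = a then θ * tiltRate ν else 0)) (2 * 2 * c) (ρ j)) ∧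
      ∀ S, 1 / 2 ≤ Q S → ENNReal.ofReal (Real.exp (-(θ ^ 2 * T)) / 4) ≤ P S := by
  let φ : Fin K → ℝ := fun j => if j = a then θ else 0
  have hφθ : ∀ j, |φ j| ≤ |θ| := fun j => by by_cases hj : j = a <;> simp [φ, hj]
  have hφ : ∀ j, |φ j| ≤ 1 := fun j => (hφθ j).trans hθ
  have hG : ∀ j, Measurable (tilt ν (φ j)) := fun j => measurable_tilt _
  have hG1 : ∀ j, ∫⁻ x, tilt ν (φ j) x ∂ν = 1 := fun j => lintegral_tilt (hφ j)
  have hG2 : ∀ j, ∫⁻ x, tilt ν (φ j) x ^ 2 ∂ν ≤ ENNReal.ofReal (1 + θ ^ 2) := fun j =>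
    (lintegral_tilt_sq_le (hφ j)).trans
      (ENNReal.ofReal_le_ofReal (add_le_add le_rfl (sq_le_sq.mpr (hφθ j))))
  refine ⟨_, h.isProbabilityMeasure_withDensity hG hG1, fun j => ν.withDensity (tilt ν (φ j)),
    fun j => isProbabilityMeasure_withDensity_tilt (hφ j), h.withDensity hG hG1, fun j => ?_,
    fun S hS => h.ofReal_exp_div_four_le_measure hG hG2 hS⟩
  simpa only [φ, ite_mul, zero_mul] using hasSubgaussianMGF_withDensity_tilt hsub (hφ j)

theorem exists_pos_le_measure_pulls (hK : 0 < K)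
    (hsub : HasSubgaussianMGF (fun x => x - ∫ y, y ∂ν) c ν)
    (hvar : 0 < variance (fun x => x) ν) (hb : 0 ≤ b) (hU : HasLogBonus U b)
    (hopt : IsOptimistic.{u} U (2 * 2 * c)) :
    ∃ q : ℝ≥0∞, 0 < q ∧ ∃ T₀ : ℕ, ∀ (Ω : Type u) [MeasurableSpace Ω] (P : Measure Ω)
      [IsProbabilityMeasure P] (T : ℕ) (A : ℕ → Ω → Fin K) (X : ℕ → Ω → ℝ) (a : Fin K), T₀ ≤ T →
      IsAdaptive P (fun _ => ν) T A X → FollowsIndex U T A X →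
      q ≤ P {ω | 9 / 10 * (T : ℝ) ≤ pulls A a T ω} := by
  have hc : 0 < c := proxy_pos_of_variance_pos hsub hvar
  have hv : 0 < tiltRate ν := tiltRate_pos hsub.integrable hvar
  obtain ⟨D, hD, T₀, hlarge⟩ := exists_half_le_measure_pulls hK hb (by positivity) hU hopt
  set h : ℝ := √D / tiltRate ν with hh
  have hhpos : 0 < h := by positivity
  refine ⟨ENNReal.ofReal (Real.exp (-h ^ 2) / 4), by simp [Real.exp_pos], max T₀ ⌈h ^ 2⌉₊,
    fun Ω _ P _ T A X a hT hA hF => ?_⟩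
  have hhT : h ^ 2 ≤ T := (Nat.le_ceil _).trans (by exact_mod_cast (le_max_right _ _).trans hT)
  have hTpos : (0 : ℝ) < T := (pow_pos hhpos 2).trans_le hhT
  set θ : ℝ := h / √T with hθ
  have hθpos : 0 < θ := by positivity
  have hθ1 : θ ≤ 1 := (div_le_one₀ (by positivity)).mpr (Real.le_sqrt_of_sq_le hhT)
  have hθT : θ ^ 2 * T = h ^ 2 := by
    rw [hθ, div_pow, Real.sq_sqrt hTpos.le, div_mul_cancel₀ _ hTpos.ne']
  have hgap : D = (θ * tiltRate ν) ^ 2 * T := by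
    rw [mul_pow, mul_right_comm, hθT, ← mul_pow, hh, div_mul_cancel₀ _ hv.ne',
      Real.sq_sqrt hD.le]
  obtain ⟨Q, _, ρ, _, hAQ, hρ, htransfer⟩ :=
    hA.exists_isAdaptive_raise_arm hsub a (abs_le.mpr ⟨by linarith, hθ1⟩)
  rw [← hθT]
  exact htransfer _ (hlarge Ω Q ρ T A X _ a (θ * tiltRate ν) ((le_max_left _ _).trans hT) hAQ hF
    hρ (by positivity) hgap.le fun j hj => by simp [hj])

theorem not_isStable {Ω : Type*} [MeasurableSpace Ω] {P : Measure Ω} {A : ℕ → ℕ → Ω → Fin K}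
    (hK : 2 ≤ K) {q : ℝ≥0∞} (hq : 0 < q)
    (hA : ∀ᶠ T : ℕ in atTop, ∀ a, q ≤ P {ω | 9 / 10 * (T : ℝ) ≤ pulls (A T) a T ω}) :
    ¬ IsStable P A := by
  intro hstable
  let a : Fin K := ⟨0, by omega⟩
  let b : Fin K := ⟨1, by omega⟩
  have hab : a ≠ b := by simp [a, b]
  obtain ⟨N, hN, hNtop⟩ := hstable a
  have hsmall := (tendstoInMeasure_iff_dist.mp hN (1 / 10) (by norm_num)).eventually
    (gt_mem_nhds hq)
  obtain ⟨T, hT, hTpos, hlt, hNpos⟩ := (hA.and ((eventually_gt_atTop 0).and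
    (hsmall.and (hNtop.eventually_gt_atTop 0)))).exists
  have hex : ∀ i, ∃ ω, 9 / 10 * (T : ℝ) ≤ pulls (A T) i T ω ∧
      |(pulls (A T) a T ω : ℝ) / N T - 1| < 1 / 10 := by
    intro i
    by_contra! hcon
    exact ((hT i).trans (measure_mono hcon)).not_gt hlt
  obtain ⟨ω, hmany, hclose⟩ := hex a
  obtain ⟨ω', hmany', hclose'⟩ := hex b
  have hsum : (pulls (A T) a T ω' : ℝ) + pulls (A T) b T ω' ≤ T := by
    have h := Finset.sum_le_sum_of_subset (f := fun i => pulls (A T) i T ω')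
      (Finset.subset_univ {a, b})
    rw [Finset.sum_pair hab, sum_pulls] at h
    exact_mod_cast h
  have hlower : 9 / 10 * (T : ℝ) < 11 / 10 * N T := by
    have := (div_lt_iff₀ hNpos).mp (sub_lt_iff_lt_add.mp (abs_lt.mp hclose).2)
    linarith
  have hupper : 9 / 10 * N T < 1 / 10 * T := by
    have := (lt_div_iff₀ hNpos).mp (lt_sub_iff_add_lt.mp (abs_lt.mp hclose').1)
    linarith
  have : (0 : ℝ) < T := by exact_mod_cast hTpos
  linarith

theorem isUnstable_of_hasLogBonus (hK : 2 ≤ K)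
    (hsub : HasSubgaussianMGF (fun x => x - ∫ y, y ∂ν) c ν)
    (hvar : 0 < variance (fun x => x) ν) (hb : 0 ≤ b) (hU : HasLogBonus U b)
    (hopt : IsOptimistic.{u} U (2 * 2 * c)) :
    IsUnstable.{u} (fun _ : Fin K => ν) U := by
  intro Ω _ P _ ε A X hI hF
  obtain ⟨q, hq, T₀, hT₀⟩ := exists_pos_le_measure_pulls (by omega) hsub hvar hb hU hopt
  refine not_isStable hK hq ?_
  filter_upwards [eventually_ge_atTop T₀] with T hT a
  exact hT₀ Ω P T (A T) (X T) a hT (hI T).isAdaptive (hF T)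

theorem isUnstable_of_anytimeMoss_le (hK : 2 ≤ K)
    (hsub : HasSubgaussianMGF (fun x => x - ∫ y, y ∂ν) c ν)
    (hvar : 0 < variance (fun x => x) ν) (hb : 0 ≤ b) (hU : HasLogBonus U b)
    (hle : ∀ (T t : ℕ) (n : Fin K → ℕ) (m : Fin K → ℝ) (a : Fin K), (∀ j, 0 < n j) → n a ≤ t →
      t ≤ T → anytimeMoss K T t n m a ≤ U T t n m a) :
    IsUnstable.{u} (fun _ : Fin K => ν) U := by
  have hc : 0 < c := proxy_pos_of_variance_pos hsub hvar
  exact isUnstable_of_hasLogBonus hK hsub hvar hb hU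
    (isOptimistic_of_anytimeMoss_le (by omega) (by positivity) hle)

end Instability

section Indices

variable {K : ℕ}

theorem max_log_div_le {x y z w : ℝ} (hz : 0 < z) (hzy : z ≤ y) (hyx : y ≤ x) (hzw : z ≤ w) :
    max 0 (Real.log (y / w)) ≤ Real.log (x / z) := by
  have hy : 0 < y := hz.trans_le hzy
  refine max_le (Real.log_nonneg ((one_le_div hz).mpr (hzy.trans hyx))) ?_
  exact Real.log_le_log (div_pos hy (hz.trans_le hzw)) (div_le_div₀ (hy.le.trans hyx) hyx hz hzw)

theorem hasLogBonus_moss (hK : 0 < K) : HasLogBonus (moss K) 1 := by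
  intro T t n m b hpos hnt htT
  have hn : (0 : ℝ) < n b := by exact_mod_cast hpos b
  have hnT : (n b : ℝ) ≤ T := by exact_mod_cast hnt.trans htT
  have hnK : (n b : ℝ) ≤ K * n b := le_mul_of_one_le_left hn.le (by exact_mod_cast hK)
  refine ⟨le_add_of_nonneg_right (Real.sqrt_nonneg _), ?_⟩
  rw [moss, one_mul]
  gcongr
  exact max_log_div_le hn hnT le_rfl hnK

theorem hasLogBonus_anytimeMoss (hK : 0 < K) : HasLogBonus (anytimeMoss K) 1 := by
  intro T t n m b hpos hnt htT
  have hn : (0 : ℝ) < n b := by exact_mod_cast hpos b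
  have hnt' : (n b : ℝ) ≤ t := by exact_mod_cast hnt
  have htT' : (t : ℝ) ≤ T := by exact_mod_cast htT
  have hnK : (n b : ℝ) ≤ K * n b := le_mul_of_one_le_left hn.le (by exact_mod_cast hK)
  refine ⟨le_add_of_nonneg_right (Real.sqrt_nonneg _), ?_⟩
  rw [anytimeMoss, one_mul]
  gcongr
  exact max_log_div_le hn hnt' htT' hnK

theorem hasLogBonus_vanillaMoss : HasLogBonus (vanillaMoss K) 1 := fun T t n m b _ _ _ =>
  ⟨le_add_of_nonneg_right (Real.sqrt_nonneg _), by rw [vanillaMoss, one_mul]⟩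

theorem hasLogBonus_ocUcb {η : ℝ} (hη : -1 < η) : HasLogBonus (ocUcb K η) (2 * (1 + η)) := by
  intro T t n m b hpos hnt htT
  have hn : (0 : ℝ) < n b := by exact_mod_cast hpos b
  have hnt' : (n b : ℝ) ≤ t := by exact_mod_cast hnt
  have htT' : (t : ℝ) ≤ T := by exact_mod_cast htT
  have hη' : 0 ≤ 1 + η := by linarith
  refine ⟨le_add_of_nonneg_right (Real.sqrt_nonneg _), ?_⟩
  rw [ocUcb, div_mul_eq_mul_div]
  gcongr
  exact div_pos ((hn.trans_le hnt').trans_le htT') (hn.trans_le hnt')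

theorem le_adaH (n : Fin K → ℕ) (b : Fin K) : (n b : ℝ) ≤ adaH n b :=
  calc (n b : ℝ) = min (n b : ℝ) (√((n b : ℝ) * (n b : ℝ))) := by
        rw [Real.sqrt_mul_self (Nat.cast_nonneg _), min_self]
    _ ≤ adaH n b := Finset.single_le_sum (f := fun j => min (n b : ℝ) (√((n b : ℝ) * (n j : ℝ))))
        (fun j _ => by positivity) (Finset.mem_univ b)

theorem adaH_le (n : Fin K → ℕ) (b : Fin K) : adaH n b ≤ K * n b :=
  calc adaH n b ≤ ∑ _j : Fin K, (n b : ℝ) := Finset.sum_le_sum fun j _ => min_le_left _ _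
    _ = K * n b := by simp

theorem hasLogBonus_adaUcb : HasLogBonus (adaUcb K) 2 := by
  intro T t n m b hpos hnt htT
  have hn : (0 : ℝ) < n b := by exact_mod_cast hpos b
  have hnT : (n b : ℝ) ≤ T := by exact_mod_cast hnt.trans htT
  refine ⟨le_add_of_nonneg_right (Real.sqrt_nonneg _), ?_⟩
  rw [adaUcb, div_mul_eq_mul_div]
  gcongr
  exact max_log_div_le hn hnT le_rfl (le_adaH n b)

variable (T t : ℕ) (n : Fin K → ℕ) (m : Fin K → ℝ) (b : Fin K)

theorem anytimeMoss_le_moss (hK : 0 < K) (hpos : ∀ j, 0 < n j) (hnt : n b ≤ t) (htT : t ≤ T) :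
    anytimeMoss K T t n m b ≤ moss K T t n m b := by
  have hn := hpos b
  have ht : 0 < t := hn.trans_le hnt
  unfold anytimeMoss moss
  gcongr

theorem anytimeMoss_le_vanillaMoss (hK : 0 < K) (hpos : ∀ j, 0 < n j) (hnt : n b ≤ t)
    (htT : t ≤ T) : anytimeMoss K T t n m b ≤ vanillaMoss K T t n m b := by
  simpa only [vanillaMoss, one_mul] using (hasLogBonus_anytimeMoss hK T t n m b hpos hnt htT).2

theorem anytimeMoss_le_adaUcb (hpos : ∀ j, 0 < n j) (hnt : n b ≤ t) (htT : t ≤ T) :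
    anytimeMoss K T t n m b ≤ adaUcb K T t n m b := by
  have hn : (0 : ℝ) < n b := by exact_mod_cast hpos b
  have hH : 0 < adaH n b := hn.trans_le (le_adaH n b)
  have ht : (0 : ℝ) < t := hn.trans_le (by exact_mod_cast hnt)
  have hlog : max 0 (Real.log (t / (K * n b))) ≤ max 0 (Real.log (T / adaH n b)) := by
    gcongr
    · exact div_pos ht (hH.trans_le (adaH_le n b))
    · exact adaH_le n b
  unfold anytimeMoss adaUcb
  rw [div_mul_eq_mul_div]
  gcongr
  linarith [le_max_left 0 (Real.log (T / adaH n b))]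

end Indices

end Bandit

theorem corollary1_general (K : ℕ) (hK : 2 ≤ K) (ν : Measure ℝ) [IsProbabilityMeasure ν]
    (c : NNReal) (hsub : HasSubgaussianMGF (fun x : ℝ => x - ∫ y, y ∂ν) c ν)
    (hvar : 0 < variance (fun x : ℝ => x) ν) (η : ℝ) (hη : -1 < η) :
    Bandit.IsUnstable.{u} (fun _ : Fin K => ν) (Bandit.moss K) ∧
    Bandit.IsUnstable.{u} (fun _ : Fin K => ν) (Bandit.anytimeMoss K) ∧
    Bandit.IsUnstable.{u} (fun _ : Fin K => ν) (Bandit.vanillaMoss K) ∧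
    Bandit.IsUnstable.{u} (fun _ : Fin K => ν) (Bandit.ocUcb K η) ∧
    Bandit.IsUnstable.{u} (fun _ : Fin K => ν) (Bandit.adaUcb K) := by
  have hK₀ : 0 < K := by omega
  have hc : 0 < c := Bandit.proxy_pos_of_variance_pos hsub hvar
  refine ⟨?moss, ?anytimeMoss, ?vanillaMoss, ?ocUcb, ?adaUcb⟩
  case moss =>
    exact Bandit.isUnstable_of_anytimeMoss_le hK hsub hvar zero_le_one
      (Bandit.hasLogBonus_moss hK₀) fun T t n m b => Bandit.anytimeMoss_le_moss T t n m b hK₀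
  case anytimeMoss =>
    exact Bandit.isUnstable_of_anytimeMoss_le hK hsub hvar zero_le_one
      (Bandit.hasLogBonus_anytimeMoss hK₀) fun _ _ _ _ _ _ _ _ => le_rfl
  case vanillaMoss =>
    exact Bandit.isUnstable_of_anytimeMoss_le hK hsub hvar zero_le_one
      Bandit.hasLogBonus_vanillaMoss
      fun T t n m b => Bandit.anytimeMoss_le_vanillaMoss T t n m b hK₀
  case ocUcb =>
    exact Bandit.isUnstable_of_hasLogBonus hK hsub hvar (by linarith)
      (Bandit.hasLogBonus_ocUcb hη) (Bandit.isOptimistic_ocUcb hη hK₀ (by positivity))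
  case adaUcb =>
    exact Bandit.isUnstable_of_anytimeMoss_le hK hsub hvar zero_le_two
      Bandit.hasLogBonus_adaUcb Bandit.anytimeMoss_le_adaUcb

theorem corollary1 (K : ℕ) (hK : 2 ≤ K) (ν : Measure ℝ) [IsProbabilityMeasure ν]
    (hsub : HasSubgaussianMGF (fun x : ℝ => x - ∫ y, y ∂ν) 1 ν)
    (hvar : 0 < variance (fun x : ℝ => x) ν)
    (η : ℝ) (hη : 0 < η) :
    Bandit.IsUnstable.{u} (fun _ : Fin K => ν) (Bandit.moss K) ∧
    Bandit.IsUnstable.{u} (fun _ : Fin K => ν) (Bandit.anytimeMoss K) ∧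
    Bandit.IsUnstable.{u} (fun _ : Fin K => ν) (Bandit.vanillaMoss K) ∧
    Bandit.IsUnstable.{u} (fun _ : Fin K => ν) (Bandit.ocUcb K η) ∧
    Bandit.IsUnstable.{u} (fun _ : Fin K => ν) (Bandit.adaUcb K) :=
  corollary1_general K hK ν 1 hsub hvar η (by linarith)
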